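/- Let $T>0$, let $u\ge 1$ and $d\ge 0$ be integers, and let $(X,Z,Y)$ be defined on a probability space $(\Omega,\mathcal F,\mathbb P)$, where: - $Y$ takes values in $\{-1,1\}$, with $p_+=\mathbb P(Y=1)>0$ and $p_-=\mathbb P(Y=-1)>0$; - $Z=(Z_t)_{t\in[0,T]}$ is a process with values in $[0,1]^d$, independent of $Y$, such that $(t,\omega)\mapsto Z_t(\omega)$ is measurable with respect to the product of the Borel $\sigma$-algebra of $[0,T]$ and $\sigma(Z)=\sigma(Z_s,\ s\in[0,T])$ (for instance, $Z$ has right-continuous paths); - $\lambda_+,\lambda_-:[0,T]\times[0,1]^d\to(0,\infty)$ are measurable; - $X=(X_t)_{t\in[0,T]}$ is a counting process (its paths are right-continuous and piecewise constant, start at $0$, and have jumps of size $1$) which is a mixture of two Cox processes: under $\mathbb P(\cdot\mid Y=1)$ (resp. $\mathbb P(\cdot\mid Y=-1)$), $\int_0^T\lambda_+(s,Z_s)\,{\rm d}s<\infty$ almost surely and, conditionally on $Z$, $X$ is a Poisson process with intensity $\lambda_+(t,Z_t)$ (resp. the same with $\lambda_-$). That is, given $\sigma(Z)$, the increments of $X$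 over successive intervals $(s,t]\subset[0,T]$ are independent and Poisson distributed with means $\int_s^t\lambda_{\pm}(r,Z_r)\,{\rm d}r$. Let $\tau=\inf\{t\in[0,T]: X_t=u\}$, where $T\wedge\tau=T$ if the set is empty, and put $X^\tau_t=X_{t\wedge\tau}$ and $Z^\tau_t=Z_{t\wedge\tau}$ for $t\in[0,T]$. Let $$\xi=\int_0^{T\wedge \tau}(\lambda_--\lambda_+)(s,Z_s)\,{\rm d}s+\int_0^{T\wedge \tau} \ln \frac{\lambda_+}{\lambda_-}(s,Z_s)\,{\rm d}X_s .$$ Then, almost surely, $$\mathbb P(Y=1\mid X^\tau,Z^\tau)=\frac{p_+}{p_-e^{-\xi}+p_+}\quad\mbox{and}\quad \mathbb P(Y=-1\mid X^\tau,Z^\tau)=\frac{p_-}{p_+e^{\xi}+p_-}.$$ Consequently, with $\eta=\mathbb P(Y=1\mid X^\tau,Z^\tau)$ and $\mathrm{sign}(t)=1$ for $t>0$ and $-1$ otherwise, the Bayes rule $g^\star(X^\tau,Z^\tau)=\mathrm{sign}(2\eta-1)$ is almost surely equal to $$\mathrm{sign}\Bigl(\xi-\ln\frac{p_-}{p_+}\Bigr),$$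 and it has the smallest probability of error among all measurable classifiers of $(X^\tau,Z^\tau)$: $\mathbb P(g^\star(X^\tau,Z^\tau)\ne Y)\le\mathbb P(g(X^\tau,Z^\tau)\neq Y)$ for every measurable $\{-1,1\}$-valued function $g$ of the pair of trajectories. Here the trajectories are elements of spaces of functions on $[0,T]$ with the $\sigma$-algebra generated by the coordinates. -/

import Mathlib

open Set Filter Topology MeasureTheory ProbabilityTheory

namespace CoxMixture

noncomputable section

/-- `x` is a counting path on `[0, T]`: it starts at `0`, is nondecreasing and right-continuous
(for the discrete topology of `ℕ`, so it is piecewise constant), and all its jumps have size one.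
Values of `x` outside `[0, T]` play no role. -/
structure IsCountingPath (T : ℝ) (x : ℝ → ℕ) : Prop where
  zero : x 0 = 0
  mono : MonotoneOn x (Icc 0 T)
  rightCont : ∀ t ∈ Ico 0 T, ContinuousWithinAt x (Ici t) t
  jump_le_one : ∀ t ∈ Ioc 0 T, ∃ s ∈ Ico 0 t, x t ≤ x s + 1

/-- The jump times in `(0, T]` of a nondecreasing integer-valued path: `x (t-) < x t`. -/
def jumpTimes (T : ℝ) (x : ℝ → ℕ) : Set ℝ :=
  {t | t ∈ Ioc 0 T ∧ ∀ s ∈ Ico 0 t, x s < x t}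

/-- A counting path has finitely many jumps on `[0, T]`. -/
theorem IsCountingPath.finite_jumpTimes {T : ℝ} {x : ℝ → ℕ} (hx : IsCountingPath T x) :
    (jumpTimes T x).Finite := by
  refine Set.Finite.of_finite_image (f := x) ((Set.finite_Iic (x T)).subset ?_) ?_
  · rintro _ ⟨t, ht, rfl⟩
    exact hx.mono ⟨ht.1.1.le, ht.1.2⟩ ⟨ht.1.1.le.trans ht.1.2, le_rfl⟩ ht.1.2
  · intro s hs t ht hst
    rcases lt_trichotomy s t with h | h | h
    · exact absurd hst (ht.2 s ⟨hs.1.1.le, h⟩).ne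
    · exact h
    · exact absurd hst.symm (hs.2 t ⟨ht.1.1.le, h⟩).ne

/-- The pathwise Lebesgue-Stieltjes integral of `f` over `(0, t]` with respect to a counting
path `x` on `[0, T]`: the sum of the values of `f` at the (finitely many, unit) jumps of `x`
up to time `t`. -/
def jumpIntegral (T : ℝ) (x : ℝ → ℕ) (f : ℝ → ℝ) (t : ℝ) : ℝ :=
  ∑ᶠ s ∈ jumpTimes T x ∩ Iic t, f s

/-- The first time in `[0, T]` at which the path `x` is equal to `u`; it is `T` if there is no
such time. -/
def hitTime (T : ℝ) (u : ℕ) (x : ℝ → ℕ) : ℝ :=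
  sInf (insert T {t | t ∈ Icc 0 T ∧ x t = u})

variable {Ω : Type*}

/-- The random time `τ` of the `u`-th jump of the process `X` (equal to `T` if there are fewer
than `u` jumps on `[0, T]`). -/
def tau (T : ℝ) (u : ℕ) (X : ℝ → Ω → ℕ) (ω : Ω) : ℝ :=
  hitTime T u (fun t => X t ω)

/-- The process `V` stopped at the random time `σ`. -/
def stopAt {E : Type*} (V : ℝ → Ω → E) (σ : Ω → ℝ) : ℝ → Ω → E :=
  fun t ω => V (min t (σ ω)) ω

/-- The trajectory on `[0, T]` of a process, as a random element of a function space
(which carries the product σ-algebra, generated by the coordinates). -/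
def pathOn {E : Type*} (T : ℝ) (V : ℝ → Ω → E) (ω : Ω) : Icc (0 : ℝ) T → E :=
  fun t => V t ω

/-- The space of pairs of trajectories on `[0, T]`. -/
abbrev ObsSpace (T : ℝ) (d : ℕ) : Type :=
  (Icc (0 : ℝ) T → ℕ) × (Icc (0 : ℝ) T → Fin d → ℝ)

/-- The observation `(X^τ, Z^τ)`. -/
def obs {d : ℕ} (T : ℝ) (u : ℕ) (X : ℝ → Ω → ℕ) (Z : ℝ → Ω → Fin d → ℝ) (ω : Ω) :
    ObsSpace T d :=
  (pathOn T (stopAt X (tau T u X)) ω, pathOn T (stopAt Z (tau T u X)) ω)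

/-- The σ-algebra generated by the random element `V`. -/
abbrev sigmaOf {E : Type*} [MeasurableSpace E] (V : Ω → E) : MeasurableSpace Ω :=
  MeasurableSpace.comap V inferInstance

/-- `Z` is a measurable process on `[0, T]` with values in `[0, 1]^d`. As a function of time and
of the trajectory of `Z`, the value `Z_t` is jointly measurable, that is, `(t, ω) ↦ Z_t (ω)` is
measurable for the Borel σ-algebra of `[0, T]` times the σ-algebra generated by the trajectory
of `Z`. Every process with right-continuous (or left-continuous) trajectories satisfies this. -/
structure IsCovariable {d : ℕ} [MeasurableSpace Ω] (T : ℝ) (Z : ℝ → Ω → Fin d → ℝ) : Prop where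
  measurable : ∀ t ∈ Icc (0 : ℝ) T, Measurable (Z t)
  jointly_measurable :
    Measurable[(inferInstance : MeasurableSpace (Icc (0 : ℝ) T)).prod (sigmaOf (pathOn T Z))]
      fun p : Icc (0 : ℝ) T × Ω => Z p.1 p.2
  mem_cube : ∀ t ∈ Icc (0 : ℝ) T, ∀ ω, Z t ω ∈ Icc (0 : Fin d → ℝ) 1

/-- `lam` is a measurable, (strictly) positive function on `[0, T] × [0, 1]^d`. -/
structure IsIntensity {d : ℕ} (T : ℝ) (lam : ℝ → (Fin d → ℝ) → ℝ) : Prop where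
  measurable : Measurable
    ((Icc (0 : ℝ) T ×ˢ Icc (0 : Fin d → ℝ) 1).domRestrict (Function.uncurry lam))
  pos : ∀ t ∈ Icc (0 : ℝ) T, ∀ z ∈ Icc (0 : Fin d → ℝ) 1, 0 < lam t z

/-- Probability that a Poisson variable with mean `m` is equal to `k`. -/
def poissonProb (m : ℝ) (k : ℕ) : ℝ := Real.exp (-m) * m ^ k / (k.factorial : ℝ)

/-- Under the probability `Q`, the counting process `X` on `[0, T]` is a Cox process with
intensity `lam t (Z t)` driven by the process `Z`: the intensity is almost surely integrable and,
conditionally on (the whole trajectory of) `Z`, the increments of `X` over successive intervals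
are independent, Poisson distributed, with means the integrals of the intensity. -/
structure IsCox {d : ℕ} [MeasurableSpace Ω] (Q : Measure Ω) (T : ℝ) (X : ℝ → Ω → ℕ)
    (Z : ℝ → Ω → Fin d → ℝ) (lam : ℝ → (Fin d → ℝ) → ℝ) : Prop where
  counting : ∀ ω, IsCountingPath T (fun t => X t ω)
  measurable : ∀ t ∈ Icc (0 : ℝ) T, Measurable (X t)
  integrable : ∀ᵐ ω ∂Q, IntegrableOn (fun s => lam s (Z s ω)) (Icc 0 T)
  increments : ∀ (n : ℕ) (t : Fin (n + 1) → ℝ) (k : Fin n → ℕ), Monotone t →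
    (∀ i, t i ∈ Icc (0 : ℝ) T) →
    Q⟦{ω | ∀ i : Fin n, X (t i.succ) ω = X (t i.castSucc) ω + k i} | sigmaOf (pathOn T Z)⟧
      =ᵐ[Q] fun ω =>
        ∏ i : Fin n, poissonProb (∫ s in (t i.castSucc)..(t i.succ), lam s (Z s ω)) (k i)

/-- The random variable
`ξ = ∫_0^{T∧τ} (λ₋ - λ₊)(s, Z_s) ds + ∫_0^{T∧τ} ln (λ₊ / λ₋)(s, Z_s) dX_s`. -/
def xi {d : ℕ} (T : ℝ) (u : ℕ) (X : ℝ → Ω → ℕ) (Z : ℝ → Ω → Fin d → ℝ)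
    (lamPos lamNeg : ℝ → (Fin d → ℝ) → ℝ) (ω : Ω) : ℝ :=
  (∫ s in (0 : ℝ)..(min T (tau T u X ω)), (lamNeg s (Z s ω) - lamPos s (Z s ω))) +
    jumpIntegral T (fun t => X t ω)
      (fun s => Real.log (lamPos s (Z s ω) / lamNeg s (Z s ω))) (min T (tau T u X ω))

/-- The sign with values in `{-1, 1}`: `1` for `t > 0` and `-1` otherwise. -/
def sgn (t : ℝ) : ℤ := if 0 < t then 1 else -1

/-- A measurable decision rule with values in `{-1, 1}`. -/
def IsClassifier {S : Type*} [MeasurableSpace S] (g : S → ℤ) : Prop :=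
  Measurable g ∧ ∀ x, g x = 1 ∨ g x = -1

end

end CoxMixture

/-!
Fix a trajectory `v` of the covariable. Then `X` is a Poisson process with deterministic intensity
`f v` under one label and `g v` under the other, and the law of the trajectory is the same under
both labels. So Bayes' formula for the pair of `V` (the whole trajectory of the covariable) and the
increments of `X` over a finite grid is explicit: the posterior odds are the prior odds times a
quotient of products of Poisson probabilities. The path is followed up to the cell of the grid which
contains `τ`; this cell is decided by the increments up to it, so that the formula survives the
stopping (`measure_inter_gridObs`).

As the grid is refined, the logarithm of the likelihood ratio converges to `ξ`
(`tendsto_posterior`). Its drift part is an integral up to the right end of the cell of `τ`. Its jump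
part is a sum over the jumps of logarithms of quotients of cell averages of the two intensities, and
these averages converge at every Lebesgue point. Almost surely all jumps are Lebesgue points, because
the mean measure of the jumps given `V = v` is `f v s ds`, which does not charge null sets
(`IsCoxGiven.ae_jumpTimes_notMem`). The posterior probabilities are bounded, so dominated convergence
gives Bayes' formula for `V` and finitely many values of the stopped path, and a π-system argument
extends it to the σ-algebra generated by `V` and the stopped path (`measure_inter_preimage`). Stopping
at `τ` is the same as capping at `u`, as the jumps have size one.

It remains to see that the limit depends, up to a null set, on the stopped observation only,
although the joint measurability of the covariable is only assumed with respect to its whole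
trajectory. If each value of a bounded process is measurable with respect to a σ-algebra `m`, then its
time integral `W` is almost surely equal to its conditional expectation `C` given `m`: the difference
`W - C` is orthogonal to `C` and to all values of the process, so to `W`, and therefore to itself
(`aestronglyMeasurable_setIntegral_of_bounded`). This deals with the drift, and with the jump part
through cell averages taken over the cell preceding the jump (`aestronglyMeasurable_xiGiven`). The
claims about the Bayes rule follow from the posterior probability.
-/

namespace CoxMixture

/-! ### Counting paths and their hitting times -/

section Paths

variable {T : ℝ} {x : ℝ → ℕ}

theorem IsCountingPath.eventually_eq (hx : IsCountingPath T x) {t : ℝ} (ht : t ∈ Ico 0 T) :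
    ∀ᶠ s in 𝓝[≥] t, x s = x t := by
  have h := (hx.rightCont t ht).tendsto
  rwa [nhds_discrete, tendsto_pure] at h

/-- A level `k ≥ 1` which is reached before `T` is reached by a jump, and exactly: the path is
right-continuous and its jumps have size one. -/
theorem IsCountingPath.exists_jumpTime (hx : IsCountingPath T x) (hT : 0 ≤ T) {k : ℕ}
    (hk : 0 < k) (hkT : k ≤ x T) :
    ∃ s ∈ jumpTimes T x, x s = k ∧ ∀ t ∈ Icc 0 T, k ≤ x t ↔ s ≤ t := by
  set A : Set ℝ := {t | t ∈ Icc 0 T ∧ k ≤ x t} with hA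
  have hTA : T ∈ A := ⟨⟨hT, le_rfl⟩, hkT⟩
  have hbdd : BddBelow A := ⟨0, fun t ht => ht.1.1⟩
  set s := sInf A with hs
  have hs0 : 0 ≤ s := le_csInf ⟨T, hTA⟩ fun t ht => ht.1.1
  have hsT : s ≤ T := csInf_le hbdd hTA
  have hks : k ≤ x s := by
    rcases hsT.eq_or_lt with h | h
    · rwa [h]
    · obtain ⟨v, hv, hsv⟩ := mem_nhdsGE_iff_exists_Ico_subset.1 (hx.eventually_eq ⟨hs0, h⟩)
      obtain ⟨t, htA, htv⟩ := exists_lt_of_csInf_lt ⟨T, hTA⟩ (show sInf A < v from hv)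
      have : x t = x s := hsv ⟨csInf_le hbdd htA, htv⟩
      exact this ▸ htA.2
  have hspos : 0 < s := by
    refine hs0.lt_of_ne fun h => ?_
    rw [← h, hx.zero] at hks
    omega
  have hlt : ∀ t ∈ Ico 0 s, x t < k := fun t ht => by
    by_contra! h
    exact absurd (csInf_le hbdd (show t ∈ A from ⟨⟨ht.1, ht.2.le.trans hsT⟩, h⟩))
      (not_le.2 ht.2)
  obtain ⟨r, hr, hxr⟩ := hx.jump_le_one s ⟨hspos, hsT⟩
  have := hlt r hr
  refine ⟨s, ⟨⟨hspos, hsT⟩, fun t ht => (hlt t ht).trans_le hks⟩, by omega, fun t ht => ?_⟩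
  exact ⟨fun h => csInf_le hbdd ⟨ht, h⟩, fun h => hks.trans (hx.mono ⟨hs0, hsT⟩ ht h)⟩

theorem injOn_jumpTimes : InjOn x (jumpTimes T x) := by
  intro s hs t ht hst
  rcases lt_trichotomy s t with h | h | h
  · exact absurd hst (ht.2 s ⟨hs.1.1.le, h⟩).ne
  · exact h
  · exact absurd hst.symm (hs.2 t ⟨ht.1.1.le, h⟩).ne

/-- The increment of a counting path over `(l, r]` is its number of jumps there. -/
theorem IsCountingPath.card_jumpTimes (hx : IsCountingPath T x) {l r : ℝ} (hl : 0 ≤ l)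
    (hlr : l ≤ r) (hr : r ≤ T) :
    (hx.finite_jumpTimes.toFinset.filter fun s => l < s ∧ s ≤ r).card = x r - x l := by
  have hlm : l ∈ Icc 0 T := ⟨hl, hlr.trans hr⟩
  have hrm : r ∈ Icc 0 T := ⟨hl.trans hlr, hr⟩
  rw [← Nat.card_Ioc, ← Finset.card_image_of_injOn (f := x)]
  · congr 1
    ext k
    simp only [Finset.mem_image, Finset.mem_filter, Finite.mem_toFinset, Finset.mem_Ioc]
    constructor
    · rintro ⟨s, ⟨hs, hls, hsr⟩, rfl⟩
      exact ⟨hs.2 l ⟨hl, hls⟩, hx.mono ⟨hs.1.1.le, hs.1.2⟩ hrm hsr⟩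
    · rintro ⟨h1, h2⟩
      obtain ⟨s, hs, hsk, h⟩ := hx.exists_jumpTime (hl.trans (hlr.trans hr)) (k := k) (by omega)
        (h2.trans (hx.mono hrm ⟨hrm.1.trans hr, le_rfl⟩ hr))
      refine ⟨s, ⟨hs, ?_, (h r hrm).1 h2⟩, hsk⟩
      by_contra! hsl
      have := (h l hlm).2 hsl
      omega
  · exact injOn_jumpTimes.mono fun s hs => by
      simp only [Finset.coe_filter, Finite.mem_toFinset, mem_ofPred_eq] at hs
      exact hs.1

theorem hitTime_eq_of_lt (hx : IsCountingPath T x) (hT : 0 ≤ T) {u : ℕ} (h : x T < u) :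
    hitTime T u x = T := by
  have : {t | t ∈ Icc 0 T ∧ x t = u} = ∅ := by
    ext t
    simp only [mem_ofPred_eq, mem_empty_iff_false, iff_false, not_and]
    intro ht
    exact ((hx.mono ht ⟨hT, le_rfl⟩ ht.2).trans_lt h).ne
  rw [hitTime, this]
  simp

/-- If the level `u` is reached, the hitting time is a jump time, and it is the first time at
which the path is at least `u`. -/
theorem hitTime_spec (hx : IsCountingPath T x) (hT : 0 ≤ T) {u : ℕ} (hu : 0 < u)
    (h : u ≤ x T) : hitTime T u x ∈ jumpTimes T x ∧ x (hitTime T u x) = u ∧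
      ∀ t ∈ Icc 0 T, u ≤ x t ↔ hitTime T u x ≤ t := by
  obtain ⟨s, hs, hsu, hst⟩ := hx.exists_jumpTime hT hu h
  have : hitTime T u x = s := by
    refine IsLeast.csInf_eq ⟨Or.inr ⟨⟨hs.1.1.le, hs.1.2⟩, hsu⟩, ?_⟩
    rintro t (rfl | ⟨ht, htu⟩)
    · exact hs.1.2
    · exact (hst t ht).1 htu.ge
  rw [this]
  exact ⟨hs, hsu, hst⟩

theorem hitTime_mem (hx : IsCountingPath T x) (hT : 0 < T) {u : ℕ} (hu : 0 < u) :
    hitTime T u x ∈ Ioc 0 T := by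
  rcases lt_or_ge (x T) u with h | h
  · rw [hitTime_eq_of_lt hx hT.le h]; exact ⟨hT, le_rfl⟩
  · exact (hitTime_spec hx hT.le hu h).1.1

/-- At `t = T` this fails for a path which does not reach `u`: its hitting time is `T`. -/
theorem hitTime_le_iff (hx : IsCountingPath T x) (hT : 0 < T) {u : ℕ} (hu : 0 < u) {t : ℝ}
    (ht : t ∈ Ico 0 T) : hitTime T u x ≤ t ↔ u ≤ x t := by
  have ht' : t ∈ Icc 0 T := ⟨ht.1, ht.2.le⟩
  rcases lt_or_ge (x T) u with h | h
  · rw [hitTime_eq_of_lt hx hT.le h]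
    have := (hx.mono ht' ⟨hT.le, le_rfl⟩ ht.2.le).trans_lt h
    exact iff_of_false (not_le.2 ht.2) (by omega)
  · exact ((hitTime_spec hx hT.le hu h).2.2 t ht').symm

theorem apply_hitTime_le (hx : IsCountingPath T x) (hT : 0 < T) {u : ℕ} (hu : 0 < u) :
    x (hitTime T u x) ≤ u := by
  rcases lt_or_ge (x T) u with h | h
  · rw [hitTime_eq_of_lt hx hT.le h]; exact h.le
  · exact (hitTime_spec hx hT.le hu h).2.1.le

/-- Since the jumps have size one, stopping at the hitting time of `u` is capping at `u`. -/
theorem apply_min_hitTime (hx : IsCountingPath T x) (hT : 0 < T) {u : ℕ} (hu : 0 < u) {t : ℝ}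
    (ht : t ∈ Icc 0 T) : x (min t (hitTime T u x)) = min (x t) u := by
  rcases lt_or_ge (x T) u with h | h
  · have := hx.mono ht ⟨hT.le, le_rfl⟩ ht.2
    rw [hitTime_eq_of_lt hx hT.le h, min_eq_left ht.2]
    omega
  · obtain ⟨-, h2, h3⟩ := hitTime_spec hx hT.le hu h
    rcases le_or_gt (hitTime T u x) t with h' | h'
    · rw [min_eq_right h', h2, min_eq_right ((h3 t ht).2 h')]
    · have := mt (h3 t ht).1 (not_le.2 h')
      rw [min_eq_left h'.le]
      omega

theorem IsCountingPath.cap (hx : IsCountingPath T x) (u : ℕ) :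
    IsCountingPath T fun t => min (x t) u where
  zero := by simp [hx.zero]
  mono := fun s hs t ht h => min_le_min_right _ (hx.mono hs ht h)
  rightCont := fun t ht =>
    (continuous_of_discreteTopology (f := fun k : ℕ => min k u)).continuousAt.comp_continuousWithinAt
      (hx.rightCont t ht)
  jump_le_one := fun t ht => by
    obtain ⟨s, hs, h⟩ := hx.jump_le_one t ht
    exact ⟨s, hs, by omega⟩

theorem jumpTimes_cap (hx : IsCountingPath T x) (hT : 0 < T) {u : ℕ} (hu : 0 < u) :
    jumpTimes T (fun t => min (x t) u) = jumpTimes T x ∩ Iic (hitTime T u x) := by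
  have hτ := hitTime_mem hx hT hu
  ext s
  constructor
  · rintro ⟨hs, h⟩
    refine ⟨⟨hs, fun t ht => ?_⟩, ?_⟩
    · have := h t ht
      dsimp only at this
      omega
    · by_contra hlt
      rw [mem_Iic, not_le] at hlt
      have h1 := h _ ⟨hτ.1.le, hlt⟩
      have h2 := (hitTime_le_iff hx hT hu ⟨hτ.1.le, hlt.trans_le hs.2⟩).1 le_rfl
      dsimp only at h1
      omega
  · rintro ⟨hs, hsτ⟩
    refine ⟨hs.1, fun t ht => ?_⟩
    have h1 := hs.2 t ht
    have h2 := mt (hitTime_le_iff hx hT hu ⟨ht.1, ht.2.trans_le hs.1.2⟩).2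
      (not_le.2 (ht.2.trans_le hsτ))
    dsimp only
    omega

theorem jumpIntegral_hitTime (hx : IsCountingPath T x) (hT : 0 < T) {u : ℕ} (hu : 0 < u)
    (f : ℝ → ℝ) : jumpIntegral T x f (hitTime T u x) =
      ∑ s ∈ (hx.cap u).finite_jumpTimes.toFinset, f s := by
  rw [jumpIntegral, ← jumpTimes_cap hx hT hu,
    finsum_mem_eq_finite_toFinset_sum _ (hx.cap u).finite_jumpTimes]

end Paths

/-! ### Uniform grids -/

/-- The point number `i` of the uniform grid of `[0, T]` with `n + 1` cells. -/
noncomputable def gridPt (T : ℝ) (n i : ℕ) : ℝ := T * i / (n + 1)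

/-- The index of the right end of the cell of the `n`-th grid, open on the left and closed on the
right, which contains `s`. -/
noncomputable def cellIdx (T : ℝ) (n : ℕ) (s : ℝ) : ℕ := ⌈s * (n + 1) / T⌉₊

section Grid

variable {T : ℝ}

theorem cellIdx_le_iff (hT : 0 < T) {n i : ℕ} {s : ℝ} :
    cellIdx T n s ≤ i ↔ s ≤ gridPt T n i := by
  rw [cellIdx, Nat.ceil_le, gridPt, div_le_iff₀ hT, le_div_iff₀ (by positivity), mul_comm T]

theorem lt_cellIdx_iff (hT : 0 < T) {n i : ℕ} {s : ℝ} :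
    i < cellIdx T n s ↔ gridPt T n i < s := by
  rw [← not_le, cellIdx_le_iff hT, not_le]

theorem gridPt_zero (n : ℕ) : gridPt T n 0 = 0 := by simp [gridPt]

theorem gridPt_last (n : ℕ) : gridPt T n (n + 1) = T := by
  have : (n + 1 : ℝ) ≠ 0 := by positivity
  simp [gridPt, this]

theorem gridPt_mono (hT : 0 < T) (n : ℕ) : Monotone (gridPt T n) := by
  intro i j h
  unfold gridPt
  gcongr

theorem gridPt_lt (hT : 0 < T) (n : ℕ) {i j : ℕ} (h : i < j) : gridPt T n i < gridPt T n j := by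
  unfold gridPt
  gcongr

theorem gridPt_mem (hT : 0 < T) {n i : ℕ} (hi : i ≤ n + 1) : gridPt T n i ∈ Icc 0 T := by
  have h1 := gridPt_mono hT n (Nat.zero_le i)
  have h2 := gridPt_mono hT n hi
  rw [gridPt_zero] at h1
  rw [gridPt_last] at h2
  exact ⟨h1, h2⟩

theorem cellIdx_le (hT : 0 < T) {n : ℕ} {s : ℝ} (hs : s ≤ T) : cellIdx T n s ≤ n + 1 := by
  rw [cellIdx_le_iff hT, gridPt_last]
  exact hs

theorem cellIdx_pos (hT : 0 < T) {n : ℕ} {s : ℝ} (hs : 0 < s) : 0 < cellIdx T n s := by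
  rw [lt_cellIdx_iff hT, gridPt_zero]
  exact hs

theorem le_gridPt_cellIdx (hT : 0 < T) (n : ℕ) (s : ℝ) : s ≤ gridPt T n (cellIdx T n s) :=
  (cellIdx_le_iff hT).1 le_rfl

theorem gridPt_cellIdx_lt (hT : 0 < T) (n : ℕ) {s : ℝ} (hs : 0 ≤ s) :
    gridPt T n (cellIdx T n s) < s + T / (n + 1) := by
  have h : (cellIdx T n s : ℝ) < s * (n + 1) / T + 1 := Nat.ceil_lt_add_one (by positivity)
  have hn : (0 : ℝ) < n + 1 := by positivity
  calc gridPt T n (cellIdx T n s) < T * (s * (n + 1) / T + 1) / (n + 1) := by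
        unfold gridPt; gcongr
    _ = s + T / (n + 1) := by field_simp

theorem tendsto_mesh (T : ℝ) : Tendsto (fun n : ℕ => T / (n + 1 : ℝ)) atTop (𝓝 0) := by
  have := (tendsto_one_div_add_atTop_nhds_zero_nat (𝕜 := ℝ)).const_mul T
  simpa only [mul_one_div, mul_zero] using this

theorem tendsto_gridPt_cellIdx (hT : 0 < T) {s : ℝ} (hs : 0 ≤ s) :
    Tendsto (fun n => gridPt T n (cellIdx T n s)) atTop (𝓝[≥] s) := by
  refine tendsto_nhdsWithin_iff.2 ⟨?_, Eventually.of_forall fun n => le_gridPt_cellIdx hT n s⟩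
  refine tendsto_of_tendsto_of_tendsto_of_le_of_le tendsto_const_nhds
    (h := fun n : ℕ => s + T / (n + 1)) ?_ (fun n => le_gridPt_cellIdx hT n s)
    (fun n => (gridPt_cellIdx_lt hT n hs).le)
  simpa using (tendsto_mesh T).const_add s

theorem IsCountingPath.eventually_gridPt {x : ℝ → ℕ} (hx : IsCountingPath T x) (hT : 0 < T)
    {s : ℝ} (hs : s ∈ Icc 0 T) : ∀ᶠ n in atTop, x (gridPt T n (cellIdx T n s)) = x s := by
  rcases hs.2.eq_or_lt with h | h
  · refine Eventually.of_forall fun n => ?_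
    have h1 := le_gridPt_cellIdx hT n s
    have h2 := (gridPt_mem hT (cellIdx_le hT (n := n) hs.2)).2
    rw [le_antisymm (h2.trans h.ge) h1]
  · exact (tendsto_gridPt_cellIdx hT hs.1).eventually (hx.eventually_eq ⟨hs.1, h⟩)

/-- A sum over the cells of a grid, weighted with the increments of a counting path, is a sum over
the jumps of the path. -/
theorem IsCountingPath.sum_grid {x : ℝ → ℕ} (hx : IsCountingPath T x) (hT : 0 < T) (n : ℕ)
    (G : ℕ → ℝ) :
    ∑ i ∈ Finset.range (n + 1),
        ((x (gridPt T n (i + 1)) - x (gridPt T n i) : ℕ) : ℝ) * G (i + 1) =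
      ∑ s ∈ hx.finite_jumpTimes.toFinset, G (cellIdx T n s) := by
  have h1 : ∀ i ∈ Finset.range (n + 1),
      ((x (gridPt T n (i + 1)) - x (gridPt T n i) : ℕ) : ℝ) * G (i + 1) =
      ∑ s ∈ hx.finite_jumpTimes.toFinset, if cellIdx T n s = i + 1 then G (i + 1) else 0 := by
    intro i hi
    rw [Finset.mem_range] at hi
    rw [← hx.card_jumpTimes (gridPt_mem hT hi.le).1 (gridPt_mono hT n i.le_succ)
      (gridPt_mem hT hi).2, ← Finset.sum_filter, Finset.sum_const, nsmul_eq_mul]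
    congr 3
    refine Finset.filter_congr fun s _ => ?_
    rw [← lt_cellIdx_iff hT, ← cellIdx_le_iff hT]
    omega
  rw [Finset.sum_congr rfl h1, Finset.sum_comm]
  refine Finset.sum_congr rfl fun s hs => ?_
  have hs' := ((hx.finite_jumpTimes.mem_toFinset).1 hs).1
  have h2 := cellIdx_le hT (n := n) hs'.2
  have h3 := cellIdx_pos hT (n := n) hs'.1
  rw [Finset.sum_eq_single (cellIdx T n s - 1)]
  · rw [if_pos (by omega), Nat.sub_add_cancel h3]
  · intro i _ hi
    rw [if_neg (by omega)]
  · intro h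
    exact absurd (Finset.mem_range.2 (by omega)) h

end Grid

/-! ### Lebesgue points along the cells of the grids -/

/-- The integral of `f` over the cell between the points `i` and `i + 1` of the `n`-th grid. -/
noncomputable def cellMass (T : ℝ) (f : ℝ → ℝ) (n i : ℕ) : ℝ :=
  ∫ r in (gridPt T n i)..(gridPt T n (i + 1)), f r

/-- The averages of `f` over the `e`-th cell to the left of the cell containing `s` converge to
`f s` as the grid is refined. -/
def CellLebesguePt (T : ℝ) (f : ℝ → ℝ) (e : ℕ) (s : ℝ) : Prop :=
  Tendsto (fun n : ℕ => (n + 1) / T * cellMass T f n (cellIdx T n s - 1 - e)) atTop (𝓝 (f s))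

theorem tendsto_cellIdx {T : ℝ} (hT : 0 < T) {s : ℝ} (hs : 0 < s) :
    Tendsto (fun n => cellIdx T n s) atTop atTop := by
  refine tendsto_atTop.2 fun k => ?_
  have h1 : Tendsto (fun n : ℕ => s / T * ((n : ℝ) + 1)) atTop atTop :=
    (tendsto_atTop_add_const_right _ _ tendsto_natCast_atTop_atTop).const_mul_atTop (by positivity)
  filter_upwards [h1.eventually_ge_atTop (k : ℝ)] with n hn
  have h2 : s * (n + 1) / T ≤ cellIdx T n s := Nat.le_ceil _
  have h3 : s / T * ((n : ℝ) + 1) = s * (n + 1) / T := by ring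
  exact_mod_cast hn.trans (h3.le.trans h2)

/-- Lebesgue's differentiation theorem along the cells of the grids: these cells need not contain
`s`, but their distance to `s` is of the order of their length. -/
theorem ae_cellLebesguePt {T : ℝ} (hT : 0 < T) {f : ℝ → ℝ}
    (hf : ∀ a b, IntervalIntegrable f volume a b) (e : ℕ) :
    ∀ᵐ s, 0 < s → CellLebesguePt T f e s := by
  have hloc : LocallyIntegrable f volume := by
    intro x
    refine ⟨Ioc (x - 1) (x + 1), Ioc_mem_nhds (by linarith) (by linarith), ?_⟩
    exact (intervalIntegrable_iff_integrableOn_Ioc_of_le (by linarith)).1 (hf _ _)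
  filter_upwards [LocallyIntegrable.ae_hasDerivAt_integral hloc] with s hs hs0
  set F : ℝ → ℝ := fun x => ∫ t in (0 : ℝ)..x, f t with hF
  set h : ℕ → ℝ := fun n => T / (n + 1) with hh
  have hh0 : Tendsto h atTop (𝓝 0) := tendsto_mesh T
  have hlo := hasDerivAt_iff_isLittleO.1 (hs 0)
  -- a sequence at distance `O(h n)` of `s` has a first order expansion with remainder `o(h n)`
  have key : ∀ (c : ℕ → ℝ) (C : ℝ), (∀ᶠ n in atTop, |c n - s| ≤ C * h n) →
      (fun n => F (c n) - F s - (c n - s) * f s) =o[atTop] h := by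
    intro c C hc
    have hO : (fun n => c n - s) =O[atTop] h :=
      Asymptotics.IsBigO.of_bound C (hc.mono fun n hn => by
        have : 0 ≤ h n := by simp only [hh]; positivity
        rwa [Real.norm_eq_abs, Real.norm_eq_abs, abs_of_nonneg this])
    have hc0 : Tendsto c atTop (𝓝 s) := by
      simpa using (hO.trans_tendsto hh0).add_const s
    have := hlo.comp_tendsto hc0
    simp only [smul_eq_mul, Function.comp_def] at this
    exact this.trans_isBigO hO
  have hj := (tendsto_cellIdx hT hs0).eventually_ge_atTop (e + 1)
  have hgrid : ∀ n : ℕ, ∀ k : ℕ, k ≤ cellIdx T n s →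
      gridPt T n (cellIdx T n s - k) = gridPt T n (cellIdx T n s) - k * h n := by
    intro n k hk
    simp only [gridPt, hh, Nat.cast_sub hk]
    ring
  have hbd : ∀ k : ℕ, ∀ᶠ n in atTop,
      |gridPt T n (cellIdx T n s - k) - s| ≤ (k + 1) * h n := by
    intro k
    filter_upwards [(tendsto_cellIdx hT hs0).eventually_ge_atTop k] with n hn
    rw [hgrid n k hn]
    have h1 := le_gridPt_cellIdx hT n s
    have h2 := gridPt_cellIdx_lt hT n hs0.le
    have h3 : 0 ≤ h n := by simp only [hh]; positivity
    have h4 : (0 : ℝ) ≤ k * h n := by positivity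
    change gridPt T n (cellIdx T n s) < s + h n at h2
    rw [abs_le]
    constructor <;> linarith
  have hdiff := (key _ _ (hbd e)).sub (key _ _ (hbd (e + 1)))
  have hlim := hdiff.tendsto_div_nhds_zero.add_const (f s)
  rw [zero_add] at hlim
  refine hlim.congr' ?_
  filter_upwards [hj] with n hn
  have hb := hgrid n e (by omega)
  have ha := hgrid n (e + 1) hn
  have hidx : cellIdx T n s - 1 - e = cellIdx T n s - (e + 1) := by omega
  have hidx' : cellIdx T n s - (e + 1) + 1 = cellIdx T n s - e := by omega
  have hint : cellMass T f n (cellIdx T n s - 1 - e) =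
      F (gridPt T n (cellIdx T n s - e)) - F (gridPt T n (cellIdx T n s - (e + 1))) := by
    rw [hidx, cellMass, hidx', hF]
    exact (intervalIntegral.integral_interval_sub_left (hf _ _) (hf _ _)).symm
  rw [hint]
  have hhn : 0 < h n := by simp only [hh]; positivity
  have hinv : ((n : ℝ) + 1) / T = (h n)⁻¹ := by simp [hh]
  rw [hinv, inv_mul_eq_div, eq_div_iff hhn.ne', add_mul, div_mul_cancel₀ _ hhn.ne']
  have hba : gridPt T n (cellIdx T n s - e) - gridPt T n (cellIdx T n s - (e + 1)) = h n := by
    rw [hb, ha]; push_cast; ring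
  linear_combination (-(f s)) * hba

/-- The sum over the jumps of the logarithms of the ratios of the masses of the cells converges to
the sum of the logarithms of the ratios of the intensities. -/
theorem tendsto_sum_log_cellMass {T : ℝ} (hT : 0 < T) {f g : ℝ → ℝ} (hf : ∀ s, 0 < f s)
    (hg : ∀ s, 0 < g s) (e : ℕ) (D : Finset ℝ) (hfD : ∀ s ∈ D, CellLebesguePt T f e s)
    (hgD : ∀ s ∈ D, CellLebesguePt T g e s) :
    Tendsto (fun n => ∑ s ∈ D, Real.log (cellMass T f n (cellIdx T n s - 1 - e) /
      cellMass T g n (cellIdx T n s - 1 - e))) atTop (𝓝 (∑ s ∈ D, Real.log (f s / g s))) := by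
  refine tendsto_finsetSum _ fun s hs => ?_
  refine (((hfD s hs).div (hgD s hs) (hg s).ne').log (div_pos (hf s) (hg s)).ne').congr fun n => ?_
  have : ((n : ℝ) + 1) / T ≠ 0 := by positivity
  rw [Pi.div_apply, mul_div_mul_left _ _ this]

/-! ### Poisson probabilities -/

section

variable {Ω S : Type*} [mΩ : MeasurableSpace Ω] [MeasurableSpace S]

theorem poissonProb_nonneg {m : ℝ} (hm : 0 ≤ m) (k : ℕ) : 0 ≤ poissonProb m k := by
  unfold poissonProb; positivity

theorem poissonProb_pos {m : ℝ} (hm : 0 < m) (k : ℕ) : 0 < poissonProb m k := by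
  unfold poissonProb; positivity

theorem measurable_poissonProb (k : ℕ) : Measurable fun m => poissonProb m k := by
  unfold poissonProb; fun_prop

theorem tsum_poissonProb {m : ℝ} (hm : 0 ≤ m) : ∑' k, ENNReal.ofReal (poissonProb m k) = 1 := by
  have h := hasSum_one_poissonMeasure ⟨m, hm⟩
  rw [← ENNReal.ofReal_tsum_of_nonneg (fun k => poissonProb_nonneg hm k) h.summable]
  exact (congrArg ENNReal.ofReal h.tsum_eq).trans ENNReal.ofReal_one

/-- The mean of the Poisson distribution. -/
theorem tsum_mul_poissonProb {m : ℝ} (hm : 0 ≤ m) :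
    ∑' k : ℕ, (k : ENNReal) * ENNReal.ofReal (poissonProb m k) = ENNReal.ofReal m := by
  rw [tsum_eq_zero_add' ENNReal.summable]
  have h : ∀ k : ℕ, ((k + 1 : ℕ) : ENNReal) * ENNReal.ofReal (poissonProb m (k + 1)) =
      ENNReal.ofReal m * ENNReal.ofReal (poissonProb m k) := by
    intro k
    rw [← ENNReal.ofReal_natCast, ← ENNReal.ofReal_mul (by positivity), ← ENNReal.ofReal_mul hm]
    congr 1
    unfold poissonProb
    rw [Nat.factorial_succ]
    push_cast
    field_simp
    ring
  simp_rw [h]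
  rw [ENNReal.tsum_mul_left, tsum_poissonProb hm]
  simp

/-! ### Cox processes driven by a random element -/

/-- Under `Q`, the random element `V` has law `μ` and, given `V = v`, the counting process `X` is a
Poisson process on `[0, T]` with intensity `s ↦ f v s`. The conditioning is expressed by the joint
law of `V` and the increments of `X`. The intensity is defined on the whole line, where it is
positive and, for almost every `v`, locally integrable. -/
structure IsCoxGiven (Q : Measure Ω) (T : ℝ) (X : ℝ → Ω → ℕ) (V : Ω → S) (μ : Measure S)
    (f : S → ℝ → ℝ) : Prop where
  counting : ∀ ω, IsCountingPath T (fun t => X t ω)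
  measurable : ∀ t ∈ Icc (0 : ℝ) T, Measurable (X t)
  measurable_cov : Measurable V
  measurable_intensity : Measurable (Function.uncurry f)
  pos : ∀ v s, 0 < f v s
  intervalIntegrable : ∀ᵐ v ∂μ, ∀ a b, IntervalIntegrable (f v) volume a b
  increments : ∀ (n : ℕ) (t : Fin (n + 1) → ℝ) (k : Fin n → ℕ), Monotone t →
    (∀ i, t i ∈ Icc (0 : ℝ) T) → ∀ B, MeasurableSet B →
    Q (V ⁻¹' B ∩ {ω | ∀ i : Fin n, X (t i.succ) ω = X (t i.castSucc) ω + k i}) =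
      ∫⁻ v in B, ENNReal.ofReal
        (∏ i : Fin n, poissonProb (∫ s in (t i.castSucc)..(t i.succ), f v s) (k i)) ∂μ

theorem measurable_intervalIntegral {f : S → ℝ → ℝ} (hf : Measurable (Function.uncurry f))
    {Z : Type*} [MeasurableSpace Z] {v : Z → S} {a b : Z → ℝ} (hv : Measurable v)
    (ha : Measurable a) (hb : Measurable b) :
    Measurable fun z => ∫ s in (a z)..(b z), f (v z) s := by
  have key : ∀ c d : Z → ℝ, Measurable c → Measurable d →
      Measurable fun z => ∫ s in Ioc (c z) (d z), f (v z) s := by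
    intro c d hc hd
    have h1 : MeasurableSet {p : Z × ℝ | c p.1 < p.2 ∧ p.2 ≤ d p.1} :=
      (measurableSet_lt (hc.comp measurable_fst) measurable_snd).inter
        (measurableSet_le measurable_snd (hd.comp measurable_fst))
    have h2 : StronglyMeasurable (Function.uncurry fun z s =>
        {p : Z × ℝ | c p.1 < p.2 ∧ p.2 ≤ d p.1}.indicator (fun p => f (v p.1) p.2) (z, s)) :=
      ((hf.comp ((hv.comp measurable_fst).prodMk measurable_snd)).indicator h1).stronglyMeasurable
    convert (h2.integral_prod_right (ν := volume)).measurable using 2 with z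
    rw [← integral_indicator measurableSet_Ioc]
    rfl
  simp only [intervalIntegral]
  exact (key a b ha hb).sub (key b a hb ha)

theorem measurable_hitTime {Ω' : Type*} {m : MeasurableSpace Ω'} {T : ℝ} (hT : 0 < T)
    {X : ℝ → Ω' → ℕ}
    (hX : ∀ ω, IsCountingPath T (fun t => X t ω)) {u : ℕ} (hu : 0 < u)
    (h : ∀ t ∈ Ico 0 T, MeasurableSet[m] {ω | u ≤ X t ω}) :
    Measurable[m] fun ω => hitTime T u (fun t => X t ω) := by
  refine measurable_of_Iic fun t => ?_
  rcases lt_or_ge t 0 with h0 | h0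
  · convert MeasurableSet.empty using 1
    ext ω
    simpa using h0.trans (hitTime_mem (hX ω) hT hu).1
  rcases lt_or_ge t T with h1 | h1
  · convert h t ⟨h0, h1⟩ using 1
    ext ω
    exact hitTime_le_iff (hX ω) hT hu ⟨h0, h1⟩
  · convert MeasurableSet.univ using 1
    ext ω
    simpa using (hitTime_mem (hX ω) hT hu).2.trans h1

namespace IsCoxGiven

variable {Q : Measure Ω} {T : ℝ} {X : ℝ → Ω → ℕ} {V : Ω → S} {μ : Measure S} {f : S → ℝ → ℝ}

theorem measure_preimage (h : IsCoxGiven Q T X V μ f) (hT : 0 ≤ T) {B : Set S}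
    (hB : MeasurableSet B) : Q (V ⁻¹' B) = μ B := by
  have := h.increments 0 (fun _ => 0) Fin.elim0 monotone_const (fun _ => ⟨le_rfl, hT⟩) B hB
  simpa using this

theorem map_eq (h : IsCoxGiven Q T X V μ f) (hT : 0 ≤ T) : Q.map V = μ := by
  ext B hB
  rw [Measure.map_apply h.measurable_cov hB, h.measure_preimage hT hB]

/-- Given `V = v`, the expected number of jumps up to time `t` is the integral of the intensity. -/
theorem lintegral_count (h : IsCoxGiven Q T X V μ f) {t : ℝ} (ht : t ∈ Icc 0 T) {B : Set S}
    (hB : MeasurableSet B) : ∫⁻ ω in V ⁻¹' B, (X t ω : ENNReal) ∂Q =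
      ∫⁻ v in B, (∫⁻ s in Ioc 0 t, ENNReal.ofReal (f v s)) ∂μ := by
  have hXt := h.measurable t ht
  have hmeas : Measurable fun v => ∫ s in (0 : ℝ)..t, f v s :=
    measurable_intervalIntegral h.measurable_intensity measurable_id measurable_const
      measurable_const
  have hnn : ∀ v, 0 ≤ ∫ s in (0 : ℝ)..t, f v s := fun v =>
    intervalIntegral.integral_nonneg ht.1 fun s _ => (h.pos v s).le
  have hlaw : ∀ k : ℕ, Q (V ⁻¹' B ∩ X t ⁻¹' {k}) =
      ∫⁻ v in B, ENNReal.ofReal (poissonProb (∫ s in (0 : ℝ)..t, f v s) k) ∂μ := by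
    intro k
    have := h.increments 1 ![0, t] (fun _ => k) (by
      intro i j hij
      fin_cases i <;> fin_cases j <;> simp_all) (by
      intro i
      fin_cases i <;> simp [ht.1, ht.2, ht.1.trans ht.2]) B hB
    simpa [(h.counting _).zero, preimage] using this
  calc ∫⁻ ω in V ⁻¹' B, (X t ω : ENNReal) ∂Q
      = ∫⁻ k : ℕ, (k : ENNReal) ∂((Q.restrict (V ⁻¹' B)).map (X t)) :=
        (lintegral_map (measurable_of_countable fun k : ℕ => (k : ENNReal)) hXt).symm
    _ = ∑' k : ℕ, (k : ENNReal) * Q (V ⁻¹' B ∩ X t ⁻¹' {k}) := by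
        rw [lintegral_countable']
        congr 1 with k
        rw [Measure.map_apply hXt (measurableSet_singleton k),
          Measure.restrict_apply (hXt (measurableSet_singleton k)), inter_comm]
    _ = ∫⁻ v in B, ∑' k : ℕ, (k : ENNReal) *
          ENNReal.ofReal (poissonProb (∫ s in (0 : ℝ)..t, f v s) k) ∂μ := by
        have hm : ∀ k : ℕ, Measurable fun v =>
            ENNReal.ofReal (poissonProb (∫ s in (0 : ℝ)..t, f v s) k) := fun k =>
          ((measurable_poissonProb k).comp hmeas).ennreal_ofReal
        rw [lintegral_tsum fun k => ((hm k).const_mul _).aemeasurable]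
        simp_rw [hlaw, lintegral_const_mul _ (hm _)]
    _ = ∫⁻ v in B, (∫⁻ s in Ioc 0 t, ENNReal.ofReal (f v s)) ∂μ := by
        refine lintegral_congr_ae (ae_restrict_of_ae ?_)
        filter_upwards [h.intervalIntegrable] with v hv
        rw [tsum_mul_poissonProb (hnn v), intervalIntegral.integral_of_le ht.1,
          ofReal_integral_eq_lintegral_ofReal]
        · exact (intervalIntegrable_iff_integrableOn_Ioc_of_le ht.1).1 (hv 0 t)
        · exact Eventually.of_forall fun s => (h.pos v s).le

theorem tsum_measure_le (h : IsCoxGiven Q T X V μ f) {t : ℝ} (ht : t ∈ Icc 0 T) {B : Set S}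
    (hB : MeasurableSet B) : ∑' k : ℕ, Q (V ⁻¹' B ∩ {ω | k + 1 ≤ X t ω}) =
      ∫⁻ v in B, (∫⁻ s in Ioc 0 t, ENNReal.ofReal (f v s)) ∂μ := by
  rw [← h.lintegral_count ht hB]
  have hm : ∀ k : ℕ, MeasurableSet {ω | k + 1 ≤ X t ω} := fun k =>
    (h.measurable t ht) (measurableSet_Ici (a := k + 1))
  have h1 : ∀ k : ℕ, Q (V ⁻¹' B ∩ {ω | k + 1 ≤ X t ω}) =
      ∫⁻ ω in V ⁻¹' B, {ω | k + 1 ≤ X t ω}.indicator 1 ω ∂Q := fun k => by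
    rw [lintegral_indicator_one (hm k), Measure.restrict_apply (hm k), inter_comm]
  simp_rw [h1]
  rw [← lintegral_tsum fun k => (measurable_one.indicator (hm k)).aemeasurable]
  refine lintegral_congr fun ω => ?_
  rw [tsum_eq_sum (s := Finset.range (X t ω))]
  · rw [Finset.sum_congr rfl (g := fun _ => (1 : ENNReal))]
    · simp
    · intro k hk
      have hk' : ω ∈ {ω | k + 1 ≤ X t ω} := Nat.succ_le_of_lt (Finset.mem_range.1 hk)
      rw [indicator_of_mem hk', Pi.one_apply]
  · intro k hk
    rw [Finset.mem_range, not_lt] at hk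
    have hk' : ω ∉ {ω | k + 1 ≤ X t ω} := fun h' => absurd (h'.trans hk) (by omega)
    exact indicator_of_notMem hk' _

/-- The mean measure of the jumps, jointly with `V`, is `f v s ds μ(dv)`, so that no jump falls into a set whose
sections are negligible. -/
theorem ae_jumpTimes_notMem [IsFiniteMeasure μ] (h : IsCoxGiven Q T X V μ f) (hT : 0 < T)
    {N : Set (S × ℝ)} (hN : MeasurableSet N) (hN0 : ∀ᵐ v ∂μ, ∀ᵐ s, s ∈ Ioc 0 T → (v, s) ∉ N) :
    ∀ᵐ ω ∂Q, ∀ s ∈ jumpTimes T (fun t => X t ω), (V ω, s) ∉ N := by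
  set τ : ℕ → Ω → ℝ := fun k ω => hitTime T (k + 1) (fun t => X t ω) with hτ
  have hτm : ∀ k, Measurable (τ k) := fun k =>
    measurable_hitTime hT h.counting k.succ_pos fun t ht =>
      (h.measurable t ⟨ht.1, ht.2.le⟩) (measurableSet_Ici (a := k + 1))
  have hTm : T ∈ Icc 0 T := ⟨hT.le, le_rfl⟩
  have hfm : Measurable fun p : S × ℝ => ENNReal.ofReal (f p.1 p.2) :=
    h.measurable_intensity.ennreal_ofReal
  set Λ : S → ENNReal := fun v => ∫⁻ s in Ioc 0 T, ENNReal.ofReal (f v s) with hΛ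
  have hΛm : Measurable Λ := hfm.lintegral_prod_right' (ν := volume.restrict (Ioc 0 T))
  have hΛfin : ∀ᵐ v ∂μ, ∃ m : ℕ, Λ v ≤ m := by
    filter_upwards [h.intervalIntegrable] with v hv
    have : Λ v < ⊤ :=
      ((intervalIntegrable_iff_integrableOn_Ioc_of_le hT.le).1 (hv 0 T)).lintegral_lt_top
    obtain ⟨m, hm⟩ := ENNReal.exists_nat_gt this.ne
    exact ⟨m, hm.le⟩
  -- `κ` is the joint law of `V` and the jumps, summed over the jumps, and `ν` is the measure
  -- `f v s ds μ(dv)`; both are restricted to the trajectories with `Λ v ≤ m` to make them finite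
  have main : ∀ m k : ℕ, Q (V ⁻¹' {v | Λ v ≤ m} ∩ {ω | k + 1 ≤ X T ω} ∩
      {ω | (V ω, τ k ω) ∈ N}) = 0 := by
    intro m k₀
    have hBm : MeasurableSet {v | Λ v ≤ m} := measurableSet_le hΛm measurable_const
    set κ : Measure (S × ℝ) := Measure.sum fun k =>
      (Q.restrict (V ⁻¹' {v | Λ v ≤ m} ∩ {ω | k + 1 ≤ X T ω})).map fun ω => (V ω, τ k ω) with hκ
    set ν : Measure (S × ℝ) := ((μ.restrict {v | Λ v ≤ m}).prod
      (volume.restrict (Ioc 0 T))).withDensity fun p => ENNReal.ofReal (f p.1 p.2) with hν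
    have hpair : ∀ k, Measurable fun ω => (V ω, τ k ω) := fun k =>
      h.measurable_cov.prodMk (hτm k)
    have hκa : ∀ A, MeasurableSet A → κ A = ∑' k, Q (V ⁻¹' {v | Λ v ≤ m} ∩
        {ω | k + 1 ≤ X T ω} ∩ {ω | (V ω, τ k ω) ∈ A}) := by
      intro A hA
      rw [hκ, Measure.sum_apply _ hA]
      congr 1 with k
      rw [Measure.map_apply (hpair k) hA, Measure.restrict_apply ((hpair k) hA), inter_comm]
      rfl
    have hκt : ∀ B, MeasurableSet B → ∀ t ∈ Icc 0 T, ∀ C : Set ℝ, MeasurableSet C →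
        (∀ s ∈ Ioc 0 T, s ∈ C ↔ s ≤ t) → κ (B ×ˢ C) =
        ∫⁻ v in B ∩ {v | Λ v ≤ m}, (∫⁻ s in Ioc 0 t, ENNReal.ofReal (f v s)) ∂μ := by
      intro B hB t ht C hC hCt
      rw [← h.tsum_measure_le ht (hB.inter hBm), hκa _ (hB.prod hC)]
      congr 1 with k
      congr 1
      ext ω
      have h1 : τ k ω ∈ C ↔ τ k ω ≤ t := hCt _ (hitTime_mem (h.counting ω) hT k.succ_pos)
      simp only [mem_inter_iff, mem_preimage, mem_ofPred_eq, mem_prod, h1]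
      have h2 : (k + 1 ≤ X T ω ∧ τ k ω ≤ t) ↔ k + 1 ≤ X t ω := by
        constructor
        · rintro ⟨h3, h4⟩
          exact ((hitTime_spec (h.counting ω) hT.le k.succ_pos h3).2.2 t ht).2 h4
        · intro h3
          have h4 := h3.trans ((h.counting ω).mono ht hTm ht.2)
          exact ⟨h4, ((hitTime_spec (h.counting ω) hT.le k.succ_pos h4).2.2 t ht).1 h3⟩
      tauto
    have hfin : IsFiniteMeasure κ := by
      refine ⟨?_⟩
      rw [← univ_prod_univ, hκt univ .univ T hTm univ .univ fun s hs => by simp [hs.2]]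
      calc ∫⁻ v in univ ∩ {v | Λ v ≤ m}, Λ v ∂μ
          ≤ ∫⁻ v in univ ∩ {v | Λ v ≤ m}, (m : ENNReal) ∂μ :=
            setLIntegral_mono measurable_const fun v hv => hv.2
        _ = m * μ (univ ∩ {v | Λ v ≤ m}) := setLIntegral_const _ _
        _ < ⊤ := ENNReal.mul_lt_top (by simp) (measure_lt_top _ _)
    have hκν : κ = ν := by
      refine Measure.ext_prod fun {B C} hB hC => ?_
      have hslice : ∀ ρ : Measure (S × ℝ), ∀ C : Set ℝ, MeasurableSet C →
          ρ (B ×ˢ C) = ((ρ.restrict (B ×ˢ univ)).map Prod.snd) C := by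
        intro ρ C hC
        rw [Measure.map_apply measurable_snd hC, Measure.restrict_apply (measurable_snd hC)]
        congr 1
        ext p
        simp [and_comm]
      rw [hslice κ C hC, hslice ν C hC]
      congr 1
      refine Measure.ext_of_Iic _ _ fun t => ?_
      rw [← hslice κ _ measurableSet_Iic, ← hslice ν _ measurableSet_Iic]
      have hν' : ν (B ×ˢ Iic t) = ∫⁻ v in B ∩ {v | Λ v ≤ m},
          (∫⁻ s in Iic t ∩ Ioc 0 T, ENNReal.ofReal (f v s)) ∂μ := by
        rw [hν, withDensity_apply _ (hB.prod measurableSet_Iic), ← Measure.prod_restrict,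
          Measure.restrict_restrict hB, Measure.restrict_restrict measurableSet_Iic,
          lintegral_prod _ hfm.aemeasurable]
      rw [hν']
      rcases lt_or_ge t 0 with h0 | h0
      · have hE : Iic t ∩ Ioc 0 T = ∅ := by
          ext s
          simp only [mem_inter_iff, mem_Iic, mem_Ioc, mem_empty_iff_false, iff_false, not_and]
          intro h1 h2
          linarith
        rw [hκt B hB 0 ⟨le_rfl, hT.le⟩ _ measurableSet_Iic, hE]
        · simp
        · intro s hs
          exact iff_of_false (not_le.2 (h0.trans hs.1)) (not_le.2 hs.1)
      · have hE : Iic t ∩ Ioc 0 T = Ioc 0 (min t T) := by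
          ext s
          simp only [mem_inter_iff, mem_Iic, mem_Ioc, le_min_iff]
          tauto
        rw [hκt B hB (min t T) ⟨le_min h0 hT.le, min_le_right _ _⟩ _ measurableSet_Iic, hE]
        intro s hs
        simp [hs.2]
    have hνN : ν N = 0 := by
      refine withDensity_absolutelyContinuous _ _ ?_
      rw [Measure.measure_prod_null hN]
      refine ae_restrict_of_ae ?_
      filter_upwards [hN0] with v hv
      rw [Pi.zero_apply, Measure.restrict_apply (measurable_prodMk_left hN)]
      rw [ae_iff] at hv
      refine measure_mono_null (fun s hs => ?_) hv
      simp only [mem_ofPred_eq, not_forall, not_not]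
      exact ⟨hs.2, hs.1⟩
    rw [← hκν, hκa N hN, ENNReal.tsum_eq_zero] at hνN
    exact hνN k₀
  have hae : ∀ᵐ ω ∂Q, ∀ m k : ℕ, ¬ (Λ (V ω) ≤ m ∧ k + 1 ≤ X T ω ∧ (V ω, τ k ω) ∈ N) := by
    refine ae_all_iff.2 fun m => ae_all_iff.2 fun k => ?_
    rw [ae_iff]
    refine measure_mono_null (fun ω hω => ?_) (main m k)
    simp only [mem_ofPred_eq, not_not] at hω
    exact ⟨⟨hω.1, hω.2.1⟩, hω.2.2⟩
  have hΛV : ∀ᵐ ω ∂Q, ∃ m : ℕ, Λ (V ω) ≤ m := by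
    rw [← h.map_eq hT.le] at hΛfin
    exact ae_of_ae_map h.measurable_cov.aemeasurable hΛfin
  filter_upwards [hae, hΛV] with ω hω ⟨m, hm⟩ s hs hsN
  have hx := h.counting ω
  have hs0 : 0 < X s ω := (Nat.zero_le _).trans_lt (hs.2 0 ⟨le_rfl, hs.1.1⟩)
  have hsT : X s ω ≤ X T ω := hx.mono ⟨hs.1.1.le, hs.1.2⟩ hTm hs.1.2
  obtain ⟨k, hk⟩ := Nat.exists_eq_succ_of_ne_zero hs0.ne'
  have hk' : k + 1 ≤ X T ω := by omega
  obtain ⟨h1, h2, -⟩ := hitTime_spec hx hT.le k.succ_pos hk'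
  have h3 : τ k ω = s := injOn_jumpTimes h1 hs (h2.trans hk.symm)
  exact hω m k ⟨hm, hk', h3.symm ▸ hsN⟩

end IsCoxGiven

end

/-! ### Time integrals of processes adapted to a σ-algebra -/

section TimeIntegral

variable {Ω : Type*} {m mΩ : MeasurableSpace Ω} {P : Measure Ω}

theorem aestronglyMeasurable_of_tendsto {f : ℕ → Ω → ℝ} {g : Ω → ℝ}
    (hf : ∀ n, AEStronglyMeasurable[m] (f n) P)
    (h : ∀ᵐ ω ∂P, Tendsto (fun n => f n ω) atTop (𝓝 (g ω))) : AEStronglyMeasurable[m] g P := by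
  refine ⟨fun ω => limsup (fun n => (hf n).mk _ ω) atTop,
    (Measurable.limsup fun n => (hf n).stronglyMeasurable_mk.measurable).stronglyMeasurable, ?_⟩
  filter_upwards [h, ae_all_iff.2 fun n => (hf n).ae_eq_mk] with ω hω hω'
  simp_rw [hω'] at hω
  exact hω.limsup_eq.symm

variable [IsFiniteMeasure P]

theorem integral_mul_sub_condExp (hm : m ≤ mΩ) {W g : Ω → ℝ} (hW : Integrable W P)
    (hg : StronglyMeasurable[m] g) {K : ℝ} (hgK : ∀ᵐ ω ∂P, |g ω| ≤ K) :
    ∫ ω, g ω * (W ω - (P[W|m]) ω) ∂P = 0 := by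
  have hg' : AEStronglyMeasurable g P := (hg.mono hm).aestronglyMeasurable
  have h1 : Integrable (g * W) P := hW.bdd_mul hg' hgK
  have h2 : Integrable (g * P[W|m]) P := integrable_condExp.bdd_mul hg' hgK
  have h3 := integral_congr_ae (condExp_mul_of_stronglyMeasurable_left hg h1 hW)
  rw [integral_condExp hm] at h3
  simp_rw [mul_sub]
  refine (integral_sub h1 h2).trans ?_
  exact sub_eq_zero.2 h3

/-- The bounded case: the time integral `W` is equal to its conditional expectation `C`, because
`W - C` is orthogonal to `C` and to the value of the process at each time, hence to `W`. No joint
measurability in time and `m` is needed. -/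
theorem aestronglyMeasurable_setIntegral_of_bounded (hm : m ≤ mΩ) {F : Ω → ℝ → ℝ}
    (hF : Measurable (Function.uncurry F)) (hFm : ∀ s, Measurable[m] fun ω => F ω s) {K : ℝ}
    (hFK : ∀ ω s, |F ω s| ≤ K) (a b : ℝ) :
    AEStronglyMeasurable[m] (fun ω => ∫ s in Ioc a b, F ω s) P := by
  set W : Ω → ℝ := fun ω => ∫ s in Ioc a b, F ω s with hWdef
  set C : Ω → ℝ := P[W|m] with hC
  have hWm : StronglyMeasurable W :=
    hF.stronglyMeasurable.integral_prod_right (ν := volume.restrict (Ioc a b))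
  set R : ℝ := K * volume.real (Ioc a b) with hR
  have hWR : ∀ ω, |W ω| ≤ R := fun ω =>
    norm_setIntegral_le_of_norm_le_const (f := F ω) measure_Ioc_lt_top fun s _ => hFK ω s
  have hWi : Integrable W P :=
    Integrable.of_bound hWm.aestronglyMeasurable R (Eventually.of_forall hWR)
  have hCm : StronglyMeasurable[m] C := stronglyMeasurable_condExp
  have hCR : ∀ᵐ ω ∂P, |C ω| ≤ R :=
    ae_bdd_abs_condExp_of_ae_bdd_abs (Eventually.of_forall hWR)
  have hDi : Integrable (fun ω => W ω - C ω) P := hWi.sub integrable_condExp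
  have hCD : ∫ ω, C ω * (W ω - C ω) ∂P = 0 := integral_mul_sub_condExp hm hWi hCm hCR
  have hFD : ∀ s, ∫ ω, F ω s * (W ω - C ω) ∂P = 0 := fun s =>
    integral_mul_sub_condExp hm hWi (hFm s).stronglyMeasurable
      (Eventually.of_forall fun ω => hFK ω s)
  have hWD : ∫ ω, W ω * (W ω - C ω) ∂P = 0 := by
    have h1 : Integrable (Function.uncurry fun ω s => F ω s * (W ω - C ω))
        (P.prod (volume.restrict (Ioc a b))) :=
      (hDi.comp_fst (volume.restrict (Ioc a b))).bdd_mul hF.aestronglyMeasurable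
        (Eventually.of_forall fun p => hFK p.1 p.2)
    calc ∫ ω, W ω * (W ω - C ω) ∂P
        = ∫ ω, (∫ s in Ioc a b, F ω s * (W ω - C ω)) ∂P := by
          simp_rw [integral_mul_const]; rfl
      _ = ∫ s in Ioc a b, ∫ ω, F ω s * (W ω - C ω) ∂P := integral_integral_swap h1
      _ = 0 := by simp [hFD]
  have hsq : ∫ ω, (W ω - C ω) * (W ω - C ω) ∂P = 0 := by
    have h1 : Integrable (fun ω => W ω * (W ω - C ω)) P :=
      hDi.bdd_mul hWm.aestronglyMeasurable (Eventually.of_forall hWR)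
    have h2 : Integrable (fun ω => C ω * (W ω - C ω)) P :=
      hDi.bdd_mul (hCm.mono hm).aestronglyMeasurable hCR
    calc ∫ ω, (W ω - C ω) * (W ω - C ω) ∂P
        = ∫ ω, (W ω * (W ω - C ω) - C ω * (W ω - C ω)) ∂P := by simp_rw [sub_mul]
      _ = 0 := by rw [integral_sub h1 h2, hWD, hCD, sub_zero]
  have hDm : AEStronglyMeasurable (fun ω => W ω - C ω) P := hDi.aestronglyMeasurable
  rw [integral_eq_zero_iff_of_nonneg (fun ω => mul_self_nonneg _)] at hsq
  · refine ⟨C, hCm, ?_⟩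
    filter_upwards [hsq] with ω hω
    exact sub_eq_zero.1 (mul_self_eq_zero.1 hω)
  · refine hDi.bdd_mul hDm (c := R + R) ?_
    filter_upwards [hCR] with ω hω
    exact (abs_sub _ _).trans (add_le_add (hWR ω) hω)

/-- If each value of a measurable nonnegative process is `m`-measurable, then so is its time
integral, up to a null set. -/
theorem aestronglyMeasurable_intervalIntegral (hm : m ≤ mΩ) {F : Ω → ℝ → ℝ}
    (hF : Measurable (Function.uncurry F)) (hFm : ∀ s, Measurable[m] fun ω => F ω s)
    (hF0 : ∀ ω s, 0 ≤ F ω s) {a b : ℝ} (hab : a ≤ b)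
    (hFi : ∀ᵐ ω ∂P, IntervalIntegrable (F ω) volume a b) :
    AEStronglyMeasurable[m] (fun ω => ∫ s in a..b, F ω s) P := by
  simp_rw [intervalIntegral.integral_of_le hab]
  refine aestronglyMeasurable_of_tendsto
    (f := fun n ω => ∫ s in Ioc a b, min (F ω s) n) (fun n => ?_) ?_
  · refine aestronglyMeasurable_setIntegral_of_bounded hm (K := n)
      (hF.min measurable_const) (fun s => (hFm s).min measurable_const) (fun ω s => ?_) a b
    rw [abs_of_nonneg (le_min (hF0 ω s) n.cast_nonneg)]
    exact min_le_right _ _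
  · filter_upwards [hFi] with ω hω
    rw [intervalIntegrable_iff_integrableOn_Ioc_of_le hab] at hω
    have hFω : Measurable (F ω) := hF.comp measurable_prodMk_left
    refine tendsto_integral_of_dominated_convergence (F ω)
      (fun n => (hFω.min measurable_const).aestronglyMeasurable) hω (fun n => ?_) ?_
    · refine Eventually.of_forall fun s => ?_
      rw [Real.norm_eq_abs, abs_of_nonneg (le_min (hF0 ω s) n.cast_nonneg)]
      exact min_le_left _ _
    · refine Eventually.of_forall fun s => tendsto_const_nhds.congr' ?_
      obtain ⟨n₀, hn₀⟩ := exists_nat_ge (F ω s)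
      filter_upwards [eventually_ge_atTop n₀] with n hn
      exact (min_eq_left (hn₀.trans (Nat.cast_le.2 hn))).symm

end TimeIntegral

/-! ### Bayes' formula for the path observed on a grid -/

section

variable {Ω S : Type*} [mΩ : MeasurableSpace Ω] [MeasurableSpace S]

theorem measurable_countable_comp {ι : Type*} [Countable ι] {β : Type*} [MeasurableSpace β]
    {ρ : Ω → ι} (hρ : ∀ a, MeasurableSet (ρ ⁻¹' {a})) {V : Ω → S} (hV : Measurable V)
    {q : ι → S → β} (hq : ∀ a, Measurable (q a)) : Measurable fun ω => q (ρ ω) (V ω) := by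
  let _ : MeasurableSpace ι := ⊤
  have h1 : Measurable fun p : ι × S => q p.1 p.2 := measurable_from_prod_countable_right hq
  exact h1.comp ((measurable_to_countable' hρ).prodMk hV)

/-- Bayes' formula for an observation `(V, ρ)` with `ρ` countably valued: the posterior
probability of `A` is the ratio of the densities. -/
theorem measure_inter_eq_lintegral_posterior {P : Measure Ω} [IsFiniteMeasure P] {μ : Measure S}
    {A : Set Ω} (hA : MeasurableSet A) {ι : Type*} [Countable ι] {ρ : Ω → ι}
    (hρ : ∀ a, MeasurableSet (ρ ⁻¹' {a})) {V : Ω → S} (hV : Measurable V) {g h : ι → S → ℝ}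
    (hg : ∀ a, Measurable (g a)) (hh : ∀ a, Measurable (h a)) (hg0 : ∀ a v, 0 ≤ g a v)
    (hh0 : ∀ a v, 0 ≤ h a v)
    (hgA : ∀ a ∈ range ρ, ∀ B, MeasurableSet B →
      P (A ∩ (V ⁻¹' B ∩ ρ ⁻¹' {a})) = ∫⁻ v in B, ENNReal.ofReal (g a v) ∂μ)
    (hhA : ∀ a ∈ range ρ, ∀ B, MeasurableSet B →
      P (Aᶜ ∩ (V ⁻¹' B ∩ ρ ⁻¹' {a})) = ∫⁻ v in B, ENNReal.ofReal (h a v) ∂μ)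
    {B : Set S} (hB : MeasurableSet B) (C : Set ι) :
    P (A ∩ (V ⁻¹' B ∩ ρ ⁻¹' C)) = ∫⁻ ω in V ⁻¹' B ∩ ρ ⁻¹' C,
      ENNReal.ofReal (g (ρ ω) (V ω) / (g (ρ ω) (V ω) + h (ρ ω) (V ω))) ∂P := by
  have hqm : ∀ a, Measurable fun v => ENNReal.ofReal (g a v / (g a v + h a v)) := fun a =>
    ((hg a).div ((hg a).add (hh a))).ennreal_ofReal
  have hsm : ∀ a, Measurable fun v => ENNReal.ofReal (g a v + h a v) := fun a =>
    ((hg a).add (hh a)).ennreal_ofReal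
  have atom : ∀ a, P (A ∩ (V ⁻¹' B ∩ ρ ⁻¹' {a})) = ∫⁻ ω in V ⁻¹' B ∩ ρ ⁻¹' {a},
      ENNReal.ofReal (g (ρ ω) (V ω) / (g (ρ ω) (V ω) + h (ρ ω) (V ω))) ∂P := by
    intro a
    by_cases ha : a ∈ range ρ
    swap
    · have : ρ ⁻¹' {a} = ∅ := by
        ext ω
        simp only [mem_preimage, mem_singleton_iff, mem_empty_iff_false, iff_false]
        rintro rfl
        exact ha ⟨ω, rfl⟩
      simp [this]
    have hlaw : (P.restrict (ρ ⁻¹' {a})).map V =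
        μ.withDensity fun v => ENNReal.ofReal (g a v + h a v) := by
      ext B hB
      rw [Measure.map_apply hV hB, Measure.restrict_apply (hV hB), withDensity_apply _ hB,
        ← measure_inter_add_sdiff _ hA, sdiff_eq, inter_comm _ A, inter_comm _ Aᶜ,
        hgA a ha B hB, hhA a ha B hB, ← lintegral_add_left (hg a).ennreal_ofReal]
      exact lintegral_congr fun v => (ENNReal.ofReal_add (hg0 a v) (hh0 a v)).symm
    have hcongr : ∫⁻ ω in V ⁻¹' B ∩ ρ ⁻¹' {a},
        ENNReal.ofReal (g (ρ ω) (V ω) / (g (ρ ω) (V ω) + h (ρ ω) (V ω))) ∂P =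
        ∫⁻ ω in V ⁻¹' B ∩ ρ ⁻¹' {a},
          ENNReal.ofReal (g a (V ω) / (g a (V ω) + h a (V ω))) ∂P := by
      refine setLIntegral_congr_fun ((hV hB).inter (hρ a)) fun ω hω => ?_
      have : ρ ω = a := hω.2
      simp only [this]
    rw [hcongr, ← Measure.restrict_restrict (hV hB),
      ← setLIntegral_map hB (hqm a) hV, hlaw,
      setLIntegral_withDensity_eq_setLIntegral_mul _ (hsm a) (hqm a) hB, hgA a ha B hB]
    refine lintegral_congr fun v => ?_
    rw [Pi.mul_apply, ← ENNReal.ofReal_mul (add_nonneg (hg0 a v) (hh0 a v))]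
    congr 1
    -- where both densities vanish, the quotient is `0 / 0 = 0`, and so is the product
    rcases (add_nonneg (hg0 a v) (hh0 a v)).eq_or_lt with h0 | h0
    · have h1 := hg0 a v
      have h2 := hh0 a v
      rw [← h0]
      linarith
    · field_simp
  let _ : MeasurableSpace ι := ⊤
  have hρm : Measurable ρ := measurable_to_countable' hρ
  have hext : (P.restrict (A ∩ V ⁻¹' B)).map ρ = ((P.restrict (V ⁻¹' B)).withDensity fun ω =>
      ENNReal.ofReal (g (ρ ω) (V ω) / (g (ρ ω) (V ω) + h (ρ ω) (V ω)))).map ρ := by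
    refine Measure.ext_of_singleton fun a => ?_
    rw [Measure.map_apply hρm trivial, Measure.map_apply hρm trivial,
      Measure.restrict_apply (hρ a), withDensity_apply _ (hρ a), Measure.restrict_restrict (hρ a),
      inter_comm, inter_assoc, atom a, inter_comm (V ⁻¹' B)]
  have := congrArg (fun κ => κ C) hext
  rw [Measure.map_apply hρm trivial, Measure.map_apply hρm trivial,
    Measure.restrict_apply (hρm trivial), withDensity_apply _ (hρm trivial),
    Measure.restrict_restrict (hρm trivial), inter_comm, inter_assoc, inter_comm (ρ ⁻¹' C)] at this
  exact this

/-- The observation of the stopped path on the `n`-th grid: the number `j` of cells up to the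
one which contains `τ`, and the increments of the path over these cells. -/
noncomputable def gridObs (T : ℝ) (u : ℕ) (X : ℝ → Ω → ℕ) (n : ℕ) (ω : Ω) :
    Σ j, Fin j → ℕ :=
  ⟨cellIdx T n (tau T u X ω), fun i => X (gridPt T n (i + 1)) ω - X (gridPt T n i) ω⟩

/-- The probability of given increments on the cells of the `n`-th grid, for a Poisson process with
intensity `f v`. -/
noncomputable def gridWeight (T : ℝ) (f : S → ℝ → ℝ) (n : ℕ) (a : Σ j, Fin j → ℕ) (v : S) : ℝ :=
  ∏ i : Fin a.1, poissonProb (cellMass T (f v) n i) (a.2 i)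

theorem measurable_cellMass {f : S → ℝ → ℝ} (hf : Measurable (Function.uncurry f)) (T : ℝ)
    (n i : ℕ) : Measurable fun v => cellMass T (f v) n i :=
  measurable_intervalIntegral hf measurable_id measurable_const measurable_const

theorem cellMass_nonneg {T : ℝ} (hT : 0 < T) {f : ℝ → ℝ} (hf : ∀ s, 0 < f s) (n i : ℕ) :
    0 ≤ cellMass T f n i :=
  intervalIntegral.integral_nonneg (gridPt_mono hT n i.le_succ) fun s _ => (hf s).le

theorem cellMass_pos {T : ℝ} (hT : 0 < T) {f : ℝ → ℝ} (hf : ∀ s, 0 < f s)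
    (hfi : ∀ a b, IntervalIntegrable f volume a b) (n i : ℕ) : 0 < cellMass T f n i :=
  intervalIntegral.intervalIntegral_pos_of_pos (hfi _ _) hf (gridPt_lt hT n i.lt_succ_self)

theorem measurable_gridWeight {f : S → ℝ → ℝ} (hf : Measurable (Function.uncurry f)) (T : ℝ)
    (n : ℕ) (a : Σ j, Fin j → ℕ) : Measurable (gridWeight T f n a) := by
  unfold gridWeight
  exact Finset.measurable_fun_prod _ fun i _ =>
    (measurable_poissonProb _).comp (measurable_cellMass hf T n i)

theorem gridWeight_nonneg {S' : Type*} {T : ℝ} (hT : 0 < T) {f : S' → ℝ → ℝ}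
    (hf : ∀ v s, 0 < f v s) (n : ℕ) (a : Σ j, Fin j → ℕ) (v : S') : 0 ≤ gridWeight T f n a v :=
  Finset.prod_nonneg fun _ _ => poissonProb_nonneg (cellMass_nonneg hT (hf v) n _) _

section GridObs

variable {T : ℝ} {X : ℝ → Ω → ℕ} {u : ℕ}

/-- The stopped observation is decided by the increments up to the cell of `τ`: each atom of
`gridObs` is an event about finitely many increments. -/
theorem gridObs_preimage {Ω' : Type*} {X : ℝ → Ω' → ℕ}
    (hX : ∀ ω, IsCountingPath T (fun t => X t ω)) (hT : 0 < T) (hu : 0 < u) (n : ℕ)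
    {a : Σ j, Fin j → ℕ} (ha : a ∈ range (gridObs T u X n)) :
    gridObs T u X n ⁻¹' {a} = {ω | ∀ i : Fin a.1,
      X (gridPt T n (i + 1)) ω = X (gridPt T n i) ω + a.2 i} := by
  have hJ : ∀ ω, cellIdx T n (tau T u X ω) ≤ n + 1 := fun ω =>
    cellIdx_le hT (hitTime_mem (hX ω) hT hu).2
  have hJle : ∀ ω, ∀ i ≤ n, (cellIdx T n (tau T u X ω) ≤ i ↔ u ≤ X (gridPt T n i) ω) := by
    intro ω i hi
    rw [cellIdx_le_iff hT]
    refine hitTime_le_iff (hX ω) hT hu ⟨(gridPt_mem hT (by omega)).1, ?_⟩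
    have := gridPt_lt hT n (Nat.lt_succ_of_le hi)
    rwa [Nat.succ_eq_add_one, gridPt_last] at this
  have hincr : ∀ ω, ∀ i < n + 1, X (gridPt T n (i + 1)) ω =
      X (gridPt T n i) ω + (X (gridPt T n (i + 1)) ω - X (gridPt T n i) ω) := by
    intro ω i hi
    have := (hX ω).mono (gridPt_mem hT (n := n) hi.le) (gridPt_mem hT (n := n) hi)
      (gridPt_mono hT n i.le_succ)
    simp only [Nat.succ_eq_add_one] at this
    omega
  obtain ⟨ω₀, rfl⟩ := ha
  ext ω
  simp only [mem_preimage, mem_singleton_iff, mem_ofPred_eq]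
  constructor
  · have : ∀ a, gridObs T u X n ω = a → ∀ i : Fin a.1,
        X (gridPt T n (i + 1)) ω = X (gridPt T n i) ω + a.2 i := by
      rintro _ rfl i
      exact hincr ω i (i.2.trans_le (hJ ω))
    exact this _
  · intro h
    set j := cellIdx T n (tau T u X ω₀) with hj
    have hjn : j ≤ n + 1 := hJ ω₀
    have heq : ∀ i ≤ j, X (gridPt T n i) ω = X (gridPt T n i) ω₀ := by
      intro i
      induction i with
      | zero => intro _; rw [gridPt_zero, (hX ω).zero, (hX ω₀).zero]
      | succ i ih =>
        intro hi
        have h1 := h ⟨i, hi⟩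
        simp only [gridObs] at h1
        rw [h1, ih (by omega), ← hincr ω₀ i (by omega)]
    -- the cell of `τ` is the first one at whose right end the level `u` is reached, if any
    have hJj : cellIdx T n (tau T u X ω) = j := by
      refine le_antisymm ?_ ?_
      · rcases hjn.eq_or_lt with h1 | h1
        · rw [h1]; exact hJ ω
        · rw [hJle ω j (by omega), heq j le_rfl, ← hJle ω₀ j (by omega)]
      · by_contra! h1
        have h2 := (hJle ω _ (by omega)).1 le_rfl
        rw [heq _ h1.le, ← hJle ω₀ _ (by omega)] at h2
        omega
    have hform : ∀ k, cellIdx T n (tau T u X ω) = k → gridObs T u X n ω =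
        ⟨k, fun i => X (gridPt T n (i + 1)) ω - X (gridPt T n i) ω⟩ := by
      rintro _ rfl; rfl
    rw [hform j hJj, gridObs]
    congr 1
    ext i
    rw [heq _ i.2, heq _ i.2.le]

theorem measurableSet_gridObs (hX : ∀ ω, IsCountingPath T (fun t => X t ω))
    (hXm : ∀ t ∈ Icc 0 T, Measurable (X t)) (hT : 0 < T) (hu : 0 < u)
    (n : ℕ) (a : Σ j, Fin j → ℕ) : MeasurableSet (gridObs T u X n ⁻¹' {a}) := by
  by_cases ha : a ∈ range (gridObs T u X n)
  · rw [gridObs_preimage hX hT hu n ha]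
    obtain ⟨ω₀, rfl⟩ := ha
    have hJ : cellIdx T n (tau T u X ω₀) ≤ n + 1 := cellIdx_le hT (hitTime_mem (hX ω₀) hT hu).2
    have : ∀ i : Fin (gridObs T u X n ω₀).1, MeasurableSet {ω | X (gridPt T n (i + 1)) ω =
        X (gridPt T n i) ω + (gridObs T u X n ω₀).2 i} := fun i =>
      measurableSet_eq_fun (hXm _ (gridPt_mem hT (i.2.trans_le hJ)))
        ((hXm _ (gridPt_mem hT (i.2.le.trans hJ))).add_const _)
    convert MeasurableSet.iInter this using 1
    ext ω
    simp
  · have : gridObs T u X n ⁻¹' {a} = ∅ := by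
      ext ω
      simp only [mem_preimage, mem_singleton_iff, mem_empty_iff_false, iff_false]
      rintro rfl
      exact ha ⟨ω, rfl⟩
    rw [this]
    exact MeasurableSet.empty

theorem IsCoxGiven.measure_gridObs {P : Measure Ω} [IsFiniteMeasure P] {A : Set Ω}
    (hA : MeasurableSet A) {V : Ω → S} {μ : Measure S} {f : S → ℝ → ℝ}
    (h : IsCoxGiven (P[|A]) T X V μ f) (hT : 0 < T) (hu : 0 < u) (n : ℕ) {a : Σ j, Fin j → ℕ}
    (ha : a ∈ range (gridObs T u X n)) {B : Set S} (hB : MeasurableSet B) :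
    P (A ∩ (V ⁻¹' B ∩ gridObs T u X n ⁻¹' {a})) =
      ∫⁻ v in B, ENNReal.ofReal (P.real A * gridWeight T f n a v) ∂μ := by
  have hj : a.1 ≤ n + 1 := by
    obtain ⟨ω, rfl⟩ := ha
    exact cellIdx_le hT (hitTime_mem (h.counting ω) hT hu).2
  have h1 := h.increments a.1 (fun i => gridPt T n i) a.2
    (fun i k hik => gridPt_mono hT n hik)
    (fun i => gridPt_mem hT ((Nat.lt_succ_iff.1 i.2).trans hj)) B hB
  simp only [Fin.val_succ, Fin.val_castSucc] at h1
  rw [gridObs_preimage h.counting hT hu n ha, ← cond_mul_eq_inter hA, h1, mul_comm,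
    ← ofReal_measureReal, ← lintegral_const_mul _ ?_]
  · refine lintegral_congr fun v => ?_
    rw [ENNReal.ofReal_mul measureReal_nonneg]
    rfl
  · exact (measurable_gridWeight h.measurable_intensity T n a).ennreal_ofReal

/-- Bayes' formula for the stopped path on the `n`-th grid. -/
theorem measure_inter_gridObs {P : Measure Ω} [IsFiniteMeasure P] {A : Set Ω}
    (hA : MeasurableSet A) {V : Ω → S} {μ : Measure S} {f g : S → ℝ → ℝ}
    (hf : IsCoxGiven (P[|A]) T X V μ f) (hg : IsCoxGiven (P[|Aᶜ]) T X V μ g) (hT : 0 < T)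
    (hu : 0 < u) (n : ℕ) {B : Set S} (hB : MeasurableSet B) (C : Set (Σ j, Fin j → ℕ)) :
    P (A ∩ (V ⁻¹' B ∩ gridObs T u X n ⁻¹' C)) = ∫⁻ ω in V ⁻¹' B ∩ gridObs T u X n ⁻¹' C,
      ENNReal.ofReal (P.real A * gridWeight T f n (gridObs T u X n ω) (V ω) /
        (P.real A * gridWeight T f n (gridObs T u X n ω) (V ω) +
          P.real Aᶜ * gridWeight T g n (gridObs T u X n ω) (V ω))) ∂P :=
  measure_inter_eq_lintegral_posterior (g := fun a v => P.real A * gridWeight T f n a v)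
    (h := fun a v => P.real Aᶜ * gridWeight T g n a v) hA
    (measurableSet_gridObs hf.counting hf.measurable hT hu n) hf.measurable_cov
    (fun a => (measurable_gridWeight hf.measurable_intensity T n a).const_mul _)
    (fun a => (measurable_gridWeight hg.measurable_intensity T n a).const_mul _)
    (fun a v => mul_nonneg measureReal_nonneg (gridWeight_nonneg hT hf.pos n a v))
    (fun a v => mul_nonneg measureReal_nonneg (gridWeight_nonneg hT hg.pos n a v))
    (fun _ ha _ hB => hf.measure_gridObs hA hT hu n ha hB)
    (fun _ ha _ hB => hg.measure_gridObs hA.compl hT hu n ha hB) hB C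

end GridObs

end

/-! ### Convergence of the likelihood ratios -/

section

theorem poissonProb_ratio {a b : ℝ} (ha : 0 < a) (hb : 0 < b) (k : ℕ) :
    poissonProb b k = poissonProb a k * Real.exp (-(b - a + k * Real.log (a / b))) := by
  have h1 : Real.exp (-(b - a + k * Real.log (a / b))) =
      Real.exp (-b) * Real.exp a * (b / a) ^ k := by
    have : -(b - a + k * Real.log (a / b)) = -b + a + k * Real.log (b / a) := by
      rw [← inv_div b a, Real.log_inv]; ring
    rw [this, Real.exp_add, Real.exp_add, Real.exp_nat_mul, Real.exp_log (div_pos hb ha)]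
  rw [h1]
  unfold poissonProb
  rw [div_pow, Real.exp_neg a]
  have := Real.exp_ne_zero a
  field_simp

/-- On fine grids, the cells up to the one which contains the hitting time of `u` see the same
jumps as the path capped at `u`. -/
theorem eventually_sum_range_cellIdx {T : ℝ} {x : ℝ → ℕ} (hx : IsCountingPath T x) (hT : 0 < T)
    {u : ℕ} (hu : 0 < u) : ∀ᶠ n in atTop, ∀ G : ℕ → ℝ,
      ∑ i ∈ Finset.range (cellIdx T n (hitTime T u x)),
        ((x (gridPt T n (i + 1)) - x (gridPt T n i) : ℕ) : ℝ) * G (i + 1) =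
      ∑ s ∈ (hx.cap u).finite_jumpTimes.toFinset, G (cellIdx T n s) := by
  have hτ := hitTime_mem hx hT hu
  filter_upwards [hx.eventually_gridPt hT ⟨hτ.1.le, hτ.2⟩] with n hn G
  set J := cellIdx T n (hitTime T u x) with hJ
  have hJn : J ≤ n + 1 := cellIdx_le hT hτ.2
  have hXJ : x (gridPt T n J) ≤ u := hn.le.trans (apply_hitTime_le hx hT hu)
  rw [← (hx.cap u).sum_grid hT n G]
  symm
  rw [← Finset.sum_subset (Finset.range_mono hJn)]
  · refine Finset.sum_congr rfl fun i hi => ?_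
    rw [Finset.mem_range] at hi
    have h1 := hx.mono (gridPt_mem hT (n := n) (i := i + 1) (by omega)) (gridPt_mem hT hJn)
      (gridPt_mono hT n hi)
    have h2 := hx.mono (gridPt_mem hT (n := n) (i := i) (by omega))
      (gridPt_mem hT (n := n) (i := i + 1) (by omega)) (gridPt_mono hT n i.le_succ)
    rw [min_eq_left (h1.trans hXJ), min_eq_left (h2.trans (h1.trans hXJ))]
  · intro i hi hiJ
    rw [Finset.mem_range] at hi hiJ
    have hlt : gridPt T n i < T := by
      have := gridPt_lt hT n hi
      rwa [gridPt_last] at this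
    have h1 : u ≤ x (gridPt T n i) :=
      (hitTime_le_iff hx hT hu ⟨(gridPt_mem hT hi.le).1, hlt⟩).1
        ((cellIdx_le_iff hT).1 (not_lt.1 hiJ))
    have h2 := hx.mono (gridPt_mem hT (n := n) hi.le)
      (gridPt_mem hT (n := n) (i := i + 1) (by omega)) (gridPt_mono hT n i.le_succ)
    rw [min_eq_right h1, min_eq_right (h1.trans h2)]
    simp

/-- The posterior probabilities on the grids converge, if the jumps of the path are Lebesgue points
of the intensities. -/
theorem tendsto_posterior {T : ℝ} {x : ℝ → ℕ} (hx : IsCountingPath T x) (hT : 0 < T) {u : ℕ}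
    (hu : 0 < u) {f g : ℝ → ℝ} (hf : ∀ s, 0 < f s) (hg : ∀ s, 0 < g s)
    (hfi : ∀ a b, IntervalIntegrable f volume a b) (hgi : ∀ a b, IntervalIntegrable g volume a b)
    (hfx : ∀ s ∈ jumpTimes T x, CellLebesguePt T f 0 s)
    (hgx : ∀ s ∈ jumpTimes T x, CellLebesguePt T g 0 s) {p q : ℝ} (hp : 0 < p) (hq : 0 < q) :
    Tendsto (fun n =>
      p * (∏ i : Fin (cellIdx T n (hitTime T u x)), poissonProb (cellMass T f n i)
          (x (gridPt T n (i + 1)) - x (gridPt T n i))) /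
        (p * (∏ i : Fin (cellIdx T n (hitTime T u x)), poissonProb (cellMass T f n i)
            (x (gridPt T n (i + 1)) - x (gridPt T n i))) +
          q * ∏ i : Fin (cellIdx T n (hitTime T u x)), poissonProb (cellMass T g n i)
            (x (gridPt T n (i + 1)) - x (gridPt T n i)))) atTop
      (𝓝 (p / (q * Real.exp (-((∫ s in (0 : ℝ)..(hitTime T u x), (g s - f s)) +
        jumpIntegral T x (fun s => Real.log (f s / g s)) (hitTime T u x))) + p))) := by
  set τ := hitTime T u x with hτdef
  have hτ := hitTime_mem hx hT hu
  set L : ℕ → ℝ := fun n => ∑ i ∈ Finset.range (cellIdx T n τ),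
    (cellMass T g n i - cellMass T f n i +
      ((x (gridPt T n (i + 1)) - x (gridPt T n i) : ℕ) : ℝ) *
        Real.log (cellMass T f n i / cellMass T g n i)) with hL
  have hprod : ∀ n, ∏ i : Fin (cellIdx T n τ), poissonProb (cellMass T g n i)
        (x (gridPt T n (i + 1)) - x (gridPt T n i)) =
      (∏ i : Fin (cellIdx T n τ), poissonProb (cellMass T f n i)
        (x (gridPt T n (i + 1)) - x (gridPt T n i))) * Real.exp (-L n) := by
    intro n
    rw [hL, ← Finset.sum_neg_distrib, Finset.sum_range, Real.exp_sum, ← Finset.prod_mul_distrib]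
    exact Finset.prod_congr rfl fun i _ =>
      poissonProb_ratio (cellMass_pos hT hf hfi n i) (cellMass_pos hT hg hgi n i) _
  have hpos : ∀ n, 0 < ∏ i : Fin (cellIdx T n τ), poissonProb (cellMass T f n i)
        (x (gridPt T n (i + 1)) - x (gridPt T n i)) := fun n =>
    Finset.prod_pos fun i _ => poissonProb_pos (cellMass_pos hT hf hfi n i) _
  have hdrift : Tendsto (fun n => ∑ i ∈ Finset.range (cellIdx T n τ),
      (cellMass T g n i - cellMass T f n i)) atTop (𝓝 (∫ s in (0 : ℝ)..τ, (g s - f s))) := by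
    have h1 : ∀ n, ∑ i ∈ Finset.range (cellIdx T n τ), (cellMass T g n i - cellMass T f n i) =
        ∫ s in (0 : ℝ)..(gridPt T n (cellIdx T n τ)), (g s - f s) := by
      intro n
      rw [← gridPt_zero (T := T) n, ← intervalIntegral.sum_integral_adjacent_intervals
        fun k _ => (hgi _ _).sub (hfi _ _)]
      exact Finset.sum_congr rfl fun i _ => (intervalIntegral.integral_sub (hgi _ _) (hfi _ _)).symm
    simp_rw [h1]
    have hc := intervalIntegral.continuous_primitive (fun a b => (hgi a b).sub (hfi a b)) 0
    exact (hc.tendsto τ).comp ((tendsto_gridPt_cellIdx hT hτ.1.le).mono_right nhdsWithin_le_nhds)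
  have hjump : Tendsto (fun n => ∑ i ∈ Finset.range (cellIdx T n τ),
      ((x (gridPt T n (i + 1)) - x (gridPt T n i) : ℕ) : ℝ) *
        Real.log (cellMass T f n i / cellMass T g n i)) atTop
      (𝓝 (jumpIntegral T x (fun s => Real.log (f s / g s)) τ)) := by
    rw [jumpIntegral_hitTime hx hT hu]
    have hsub : ∀ s ∈ (hx.cap u).finite_jumpTimes.toFinset, s ∈ jumpTimes T x := fun s hs => by
      rw [Finite.mem_toFinset, jumpTimes_cap hx hT hu] at hs
      exact hs.1
    refine (tendsto_sum_log_cellMass hT hf hg 0 _ (fun s hs => hfx s (hsub s hs))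
      fun s hs => hgx s (hsub s hs)).congr' ?_
    filter_upwards [eventually_sum_range_cellIdx hx hT hu] with n hn
    exact (hn fun i => Real.log (cellMass T f n (i - 1) / cellMass T g n (i - 1))).symm
  have hLlim : Tendsto L atTop (𝓝 ((∫ s in (0 : ℝ)..τ, (g s - f s)) +
      jumpIntegral T x (fun s => Real.log (f s / g s)) τ)) := by
    refine (hdrift.add hjump).congr fun n => ?_
    rw [hL, ← Finset.sum_add_distrib]
  have hlim : Tendsto (fun n => p / (q * Real.exp (-L n) + p)) atTop
      (𝓝 (p / (q * Real.exp (-((∫ s in (0 : ℝ)..τ, (g s - f s)) +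
        jumpIntegral T x (fun s => Real.log (f s / g s)) τ)) + p))) := by
    refine tendsto_const_nhds.div ?_ (by positivity)
    exact (((Real.continuous_exp.tendsto _).comp hLlim.neg).const_mul q).add_const p
  refine hlim.congr fun n => ?_
  rw [hprod n]
  have h1 := hpos n
  have h2 := Real.exp_pos (-L n)
  rw [div_eq_div_iff (by positivity) (by positivity)]
  ring

variable {Ω S : Type*} [mΩ : MeasurableSpace Ω] [MeasurableSpace S]

theorem measurableSet_cellLebesguePt {f : S → ℝ → ℝ} (hf : Measurable (Function.uncurry f))
    (T : ℝ) (e : ℕ) : MeasurableSet {p : S × ℝ | CellLebesguePt T (f p.1) e p.2} := by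
  have h1 : ∀ n, Measurable fun p : S × ℝ => cellIdx T n p.2 := fun n => by
    unfold cellIdx
    exact Nat.measurable_ceil.comp (by fun_prop)
  refine measurableSet_tendsto_fun (fun n => ?_) hf
  exact (measurable_intervalIntegral hf measurable_fst
    ((measurable_of_countable fun k : ℕ => gridPt T n (k - 1 - e)).comp (h1 n))
    ((measurable_of_countable fun k : ℕ => gridPt T n (k - 1 - e + 1)).comp (h1 n))).const_mul _

theorem ae_of_ae_cond {P : Measure Ω} [IsFiniteMeasure P] {A : Set Ω} (hA : MeasurableSet A)
    {p : Ω → Prop} (h1 : ∀ᵐ ω ∂P[|A], p ω) (h2 : ∀ᵐ ω ∂P[|Aᶜ], p ω) : ∀ᵐ ω ∂P, p ω := by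
  rw [ae_iff] at h1 h2 ⊢
  rw [← cond_add_cond_compl_eq hA, h1, h2]
  simp

/-- The random variable `ξ`, with intensities which are functions of the driving element `V`. -/
noncomputable def xiGiven {Ω S : Type*} (T : ℝ) (u : ℕ) (X : ℝ → Ω → ℕ) (V : Ω → S)
    (f g : S → ℝ → ℝ) (ω : Ω) : ℝ :=
  (∫ s in (0 : ℝ)..(tau T u X ω), (g (V ω) s - f (V ω) s)) +
    jumpIntegral T (fun t => X t ω) (fun s => Real.log (f (V ω) s / g (V ω) s)) (tau T u X ω)

/-- The path capped at `u` is known at all points of the grid from the stopped observation. -/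
theorem gridObs_cap_eq {Ω' : Type*} {X : ℝ → Ω' → ℕ} {T : ℝ} {u : ℕ}
    (hX : ∀ ω, IsCountingPath T (fun t => X t ω)) (hT : 0 < T) (hu : 0 < u) (n : ℕ)
    {ω ω' : Ω'} (h : gridObs T u X n ω = gridObs T u X n ω') {i : ℕ} (hi : i ≤ n + 1) :
    min (X (gridPt T n i) ω) u = min (X (gridPt T n i) ω') u := by
  have h1 : ω ∈ gridObs T u X n ⁻¹' {gridObs T u X n ω'} := h
  have h2 : ω' ∈ gridObs T u X n ⁻¹' {gridObs T u X n ω'} := rfl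
  rw [gridObs_preimage hX hT hu n ⟨ω', rfl⟩] at h1 h2
  have hJ : cellIdx T n (tau T u X ω) = cellIdx T n (tau T u X ω') := congrArg Sigma.fst h
  have heq : ∀ i ≤ cellIdx T n (tau T u X ω'), X (gridPt T n i) ω = X (gridPt T n i) ω' := by
    intro i
    induction i with
    | zero => intro _; rw [gridPt_zero, (hX ω).zero, (hX ω').zero]
    | succ i ih =>
      intro hi
      rw [h1 ⟨i, hi⟩, h2 ⟨i, hi⟩, ih (by omega)]
  rcases le_or_gt i (cellIdx T n (tau T u X ω')) with h3 | h3
  · rw [heq i h3]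
  · have hle : ∀ ω, cellIdx T n (tau T u X ω) < i → u ≤ X (gridPt T n i) ω := by
      intro ω hω
      set J := cellIdx T n (tau T u X ω) with hJdef
      have hlt : gridPt T n J < T := by
        have := gridPt_lt hT n (hω.trans_le hi)
        rwa [gridPt_last] at this
      have h4 := (hitTime_le_iff (hX ω) hT hu
        ⟨(gridPt_mem hT (hω.le.trans hi)).1, hlt⟩).1 (le_gridPt_cellIdx hT n (tau T u X ω))
      exact h4.trans ((hX ω).mono (gridPt_mem hT (hω.le.trans hi)) (gridPt_mem hT hi)
        (gridPt_mono hT n hω.le))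
    rw [min_eq_right (hle ω (hJ ▸ h3)), min_eq_right (hle ω' h3)]

section Mixture

variable {P : Measure Ω} [IsProbabilityMeasure P] {A : Set Ω} {T : ℝ} {X : ℝ → Ω → ℕ} {u : ℕ}
  {V : Ω → S} {μ : Measure S} {f g : S → ℝ → ℝ}

theorem ae_intervalIntegrable_comp (hA : MeasurableSet A) (hf : IsCoxGiven (P[|A]) T X V μ f)
    (hg : IsCoxGiven (P[|Aᶜ]) T X V μ g) (hT : 0 < T) :
    ∀ᵐ ω ∂P, (∀ a b, IntervalIntegrable (f (V ω)) volume a b) ∧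
      ∀ a b, IntervalIntegrable (g (V ω)) volume a b := by
  have h := hf.intervalIntegrable.and hg.intervalIntegrable
  refine ae_of_ae_cond hA ?_ ?_
  · rw [← hf.map_eq hT.le] at h
    exact ae_of_ae_map hf.measurable_cov.aemeasurable h
  · rw [← hg.map_eq hT.le] at h
    exact ae_of_ae_map hf.measurable_cov.aemeasurable h

variable [IsFiniteMeasure μ]

theorem ae_cellLebesguePt_jumpTimes (hA : MeasurableSet A) (hf : IsCoxGiven (P[|A]) T X V μ f)
    (hg : IsCoxGiven (P[|Aᶜ]) T X V μ g) (hT : 0 < T) (e : ℕ) :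
    ∀ᵐ ω ∂P, ∀ s ∈ jumpTimes T (fun t => X t ω),
      CellLebesguePt T (f (V ω)) e s ∧ CellLebesguePt T (g (V ω)) e s := by
  have hN : MeasurableSet ({p : S × ℝ | CellLebesguePt T (f p.1) e p.2} ∩
      {p : S × ℝ | CellLebesguePt T (g p.1) e p.2})ᶜ :=
    ((measurableSet_cellLebesguePt hf.measurable_intensity T e).inter
      (measurableSet_cellLebesguePt hg.measurable_intensity T e)).compl
  have hN0 : ∀ᵐ v ∂μ, ∀ᵐ s, s ∈ Ioc 0 T → (v, s) ∉
      ({p : S × ℝ | CellLebesguePt T (f p.1) e p.2} ∩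
        {p : S × ℝ | CellLebesguePt T (g p.1) e p.2})ᶜ := by
    filter_upwards [hf.intervalIntegrable, hg.intervalIntegrable] with v hfv hgv
    filter_upwards [ae_cellLebesguePt hT hfv e, ae_cellLebesguePt hT hgv e] with s h1 h2 hs
    exact not_not.2 ⟨h1 hs.1, h2 hs.1⟩
  refine ae_of_ae_cond hA ?_ ?_
  · filter_upwards [hf.ae_jumpTimes_notMem hT hN hN0] with ω hω s hs
    exact not_not.1 (hω s hs)
  · filter_upwards [hg.ae_jumpTimes_notMem hT hN hN0] with ω hω s hs
    exact not_not.1 (hω s hs)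

/-- Bayes' formula for `V` and finitely many values of the stopped path: the limit of the formulas
on the grids, by dominated convergence. -/
theorem measure_inter_finite (hA : MeasurableSet A) (hf : IsCoxGiven (P[|A]) T X V μ f)
    (hg : IsCoxGiven (P[|Aᶜ]) T X V μ g) (hT : 0 < T) (hu : 0 < u) (hp : 0 < P.real A)
    (hq : 0 < P.real Aᶜ) {B : Set S} (hB : MeasurableSet B) (I : Finset (Icc (0 : ℝ) T))
    (k : I → ℕ) :
    P (A ∩ (V ⁻¹' B ∩ {ω | ∀ t : I, min (X t ω) u = k t})) =
      ∫⁻ ω in V ⁻¹' B ∩ {ω | ∀ t : I, min (X t ω) u = k t}, ENNReal.ofReal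
        (P.real A / (P.real Aᶜ * Real.exp (-xiGiven T u X V f g ω) + P.real A)) ∂P := by
  have hX := hf.counting
  set E : Set Ω := {ω | ∀ t : I, min (X t ω) u = k t} with hE
  -- the times are approximated from the right by points of the grids
  set En : ℕ → Set Ω := fun n =>
    {ω | ∀ t : I, min (X (gridPt T n (cellIdx T n t)) ω) u = k t} with hEn
  have hidx : ∀ n (t : I), cellIdx T n t ≤ n + 1 := fun n t => cellIdx_le hT t.1.2.2
  have hcap : Measurable fun j : ℕ => min j u := measurable_of_countable _
  have hEm : MeasurableSet E := by
    have : E = ⋂ t : I, {ω | min (X t ω) u = k t} := by ext; simp [hE]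
    rw [this]
    exact MeasurableSet.iInter fun t =>
      (hcap.comp (hf.measurable _ t.1.2)) (measurableSet_singleton (k t))
  have hEnm : ∀ n, MeasurableSet (En n) := fun n => by
    have : En n = ⋂ t : I, {ω | min (X (gridPt T n (cellIdx T n t)) ω) u = k t} := by
      ext; simp [hEn]
    rw [this]
    exact MeasurableSet.iInter fun t =>
      (hcap.comp (hf.measurable _ (gridPt_mem hT (hidx n t)))) (measurableSet_singleton (k t))
  have hVB := hf.measurable_cov hB
  have hpre : ∀ n, En n = gridObs T u X n ⁻¹' (gridObs T u X n '' En n) := by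
    intro n
    refine (subset_preimage_image _ _).antisymm ?_
    rintro ω ⟨ω', hω', h⟩ t
    rw [← hω' t, gridObs_cap_eq hX hT hu n h (hidx n t)]
  have hev : ∀ ω, ∀ᶠ n in atTop, (ω ∈ En n ↔ ω ∈ E) := by
    intro ω
    have : ∀ᶠ n in atTop, ∀ t : I, X (gridPt T n (cellIdx T n t)) ω = X t ω :=
      eventually_all.2 fun t => (hX ω).eventually_gridPt hT t.1.2
    filter_upwards [this] with n hn
    exact forall_congr' fun t => by rw [hn t]
  set q : ℕ → Ω → ℝ := fun n ω =>
    P.real A * gridWeight T f n (gridObs T u X n ω) (V ω) /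
        (P.real A * gridWeight T f n (gridObs T u X n ω) (V ω) +
          P.real Aᶜ * gridWeight T g n (gridObs T u X n ω) (V ω)) with hqdef
  have hqm : ∀ n, Measurable (q n) := fun n => by
    have hfm := measurable_countable_comp (measurableSet_gridObs hX hf.measurable hT hu n)
      hf.measurable_cov (measurable_gridWeight hf.measurable_intensity T n)
    have hgm := measurable_countable_comp (measurableSet_gridObs hX hf.measurable hT hu n)
      hf.measurable_cov (measurable_gridWeight hg.measurable_intensity T n)
    exact (hfm.const_mul _).div ((hfm.const_mul _).add (hgm.const_mul _))
  have hq1 : ∀ n ω, q n ω ≤ 1 := fun n ω => by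
    have h1 := gridWeight_nonneg hT hf.pos n (gridObs T u X n ω) (V ω)
    have h2 := gridWeight_nonneg hT hg.pos n (gridObs T u X n ω) (V ω)
    exact div_le_one_of_le₀ (le_add_of_nonneg_right (by positivity)) (by positivity)
  have hqlim : ∀ᵐ ω ∂P, Tendsto (fun n => q n ω) atTop
      (𝓝 (P.real A / (P.real Aᶜ * Real.exp (-xiGiven T u X V f g ω) + P.real A))) := by
    filter_upwards [ae_intervalIntegrable_comp hA hf hg hT,
      ae_cellLebesguePt_jumpTimes hA hf hg hT 0] with ω h1 h2
    exact tendsto_posterior (hX ω) hT hu (hf.pos _) (hg.pos _) h1.1 h1.2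
      (fun s hs => (h2 s hs).1) (fun s hs => (h2 s hs).2) hp hq
  have hone : ∫⁻ _, (1 : ENNReal) ∂P ≠ ⊤ := by simp
  have hleft : Tendsto (fun n => P (A ∩ (V ⁻¹' B ∩ En n))) atTop
      (𝓝 (P (A ∩ (V ⁻¹' B ∩ E)))) := by
    simp_rw [← fun n => lintegral_indicator_one (μ := P) (hA.inter (hVB.inter (hEnm n))),
      ← lintegral_indicator_one (μ := P) (hA.inter (hVB.inter hEm))]
    refine tendsto_lintegral_of_dominated_convergence (fun _ => 1)
      (fun n => measurable_one.indicator (hA.inter (hVB.inter (hEnm n))))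
      (fun n => Eventually.of_forall fun ω => indicator_le_self _ _ _) hone
      (Eventually.of_forall fun ω => tendsto_const_nhds.congr' ?_)
    filter_upwards [hev ω] with n hn
    have h' : ω ∈ A ∩ (V ⁻¹' B ∩ En n) ↔ ω ∈ A ∩ (V ⁻¹' B ∩ E) :=
      and_congr_right fun _ => and_congr_right fun _ => hn
    by_cases h : ω ∈ A ∩ (V ⁻¹' B ∩ E)
    · rw [indicator_of_mem h, indicator_of_mem (h'.2 h)]
    · rw [indicator_of_notMem h, indicator_of_notMem (mt h'.1 h)]
  have hright : Tendsto (fun n => ∫⁻ ω in V ⁻¹' B ∩ En n, ENNReal.ofReal (q n ω) ∂P) atTop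
      (𝓝 (∫⁻ ω in V ⁻¹' B ∩ E, ENNReal.ofReal
        (P.real A / (P.real Aᶜ * Real.exp (-xiGiven T u X V f g ω) + P.real A)) ∂P)) := by
    simp_rw [← fun n => lintegral_indicator (μ := P) (hVB.inter (hEnm n)),
      ← lintegral_indicator (μ := P) (hVB.inter hEm)]
    refine tendsto_lintegral_of_dominated_convergence (fun _ => 1)
      (fun n => (hqm n).ennreal_ofReal.indicator (hVB.inter (hEnm n)))
      (fun n => Eventually.of_forall fun ω => ?_) hone ?_
    · exact (indicator_le_self _ _ ω).trans (ENNReal.ofReal_le_one.2 (hq1 n ω))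
    · filter_upwards [hqlim] with ω hω
      by_cases h : ω ∈ V ⁻¹' B ∩ E
      · rw [indicator_of_mem h]
        refine (ENNReal.tendsto_ofReal hω).congr' ?_
        filter_upwards [hev ω] with n hn
        have h' : ω ∈ V ⁻¹' B ∩ En n := ⟨h.1, hn.2 h.2⟩
        rw [indicator_of_mem h']
      · rw [indicator_of_notMem h]
        refine tendsto_const_nhds.congr' ?_
        filter_upwards [hev ω] with n hn
        have h' : ω ∉ V ⁻¹' B ∩ En n := fun h' => h ⟨h'.1, hn.1 h'.2⟩
        rw [indicator_of_notMem h']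
  refine tendsto_nhds_unique hleft (hright.congr fun n => ?_)
  rw [hpre n]
  exact (measure_inter_gridObs hA hf hg hT hu n hB _).symm

/-- Bayes' formula for `V` and the stopped path. -/
theorem measure_inter_preimage (hA : MeasurableSet A) (hf : IsCoxGiven (P[|A]) T X V μ f)
    (hg : IsCoxGiven (P[|Aᶜ]) T X V μ g) (hT : 0 < T) (hu : 0 < u) (hp : 0 < P.real A)
    (hq : 0 < P.real Aᶜ) {E : Set (S × (Icc (0 : ℝ) T → ℕ))} (hE : MeasurableSet E) :
    P (A ∩ (fun ω => (V ω, fun t : Icc (0 : ℝ) T => min (X t ω) u)) ⁻¹' E) =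
      ∫⁻ ω in (fun ω => (V ω, fun t : Icc (0 : ℝ) T => min (X t ω) u)) ⁻¹' E, ENNReal.ofReal
        (P.real A / (P.real Aᶜ * Real.exp (-xiGiven T u X V f g ω) + P.real A)) ∂P := by
  set η : Ω → ENNReal := fun ω => ENNReal.ofReal
    (P.real A / (P.real Aᶜ * Real.exp (-xiGiven T u X V f g ω) + P.real A)) with hη
  set Y : Ω → Icc (0 : ℝ) T → ℕ := fun ω t => min (X t ω) u with hY
  have hYm : Measurable Y := measurable_pi_lambda _ fun t =>
    (measurable_of_countable fun j : ℕ => min j u).comp (hf.measurable _ t.2)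
  have hWm : Measurable fun ω => (V ω, Y ω) := hf.measurable_cov.prodMk hYm
  have hext : (P.restrict A).map (fun ω => (V ω, Y ω)) =
      (P.withDensity η).map (fun ω => (V ω, Y ω)) := by
    refine Measure.ext_prod fun {B C} hB hC => ?_
    have hVB := hf.measurable_cov hB
    rw [Measure.map_apply hWm (hB.prod hC), Measure.map_apply hWm (hB.prod hC)]
    have hpath : ((P.restrict A).restrict (V ⁻¹' B)).map Y =
        ((P.withDensity η).restrict (V ⁻¹' B)).map Y := by
      refine IsProjectiveLimit.unique (P := fun I =>
        ((((P.restrict A).restrict (V ⁻¹' B)).map Y).map I.restrict)) (fun I => rfl) fun I => ?_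
      have hr : Measurable (I.restrict (π := fun _ : Icc (0 : ℝ) T => ℕ)) :=
        Finset.measurable_restrict I
      refine Measure.ext_of_singleton fun k => ?_
      have hk : (Y ⁻¹' (I.restrict ⁻¹' {k})) = {ω | ∀ t : I, min (X t ω) u = k t} := by
        ext ω
        simp only [mem_preimage, mem_singleton_iff, funext_iff]
        rfl
      have hkm : MeasurableSet {ω | ∀ t : I, min (X t ω) u = k t} :=
        hk ▸ hYm (hr (measurableSet_singleton k))
      rw [Measure.map_apply hr (measurableSet_singleton k),
        Measure.map_apply hr (measurableSet_singleton k),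
        Measure.map_apply hYm (hr (measurableSet_singleton k)),
        Measure.map_apply hYm (hr (measurableSet_singleton k)), hk, Measure.restrict_apply hkm,
        Measure.restrict_apply hkm, Measure.restrict_apply (hkm.inter hVB),
        withDensity_apply _ (hkm.inter hVB), inter_comm _ (V ⁻¹' B), inter_comm _ A,
        measure_inter_finite hA hf hg hT hu hp hq hB I k]
    have h1 : (fun ω => (V ω, Y ω)) ⁻¹' (B ×ˢ C) = Y ⁻¹' C ∩ V ⁻¹' B := by
      ext ω
      simp [and_comm]
    have h2 := congrArg (fun κ : Measure (Icc (0 : ℝ) T → ℕ) => κ C) hpath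
    simp only [Measure.map_apply hYm hC, Measure.restrict_apply (hYm hC)] at h2
    rw [h1]
    exact h2
  have h2 := congrArg (fun κ : Measure (S × (Icc (0 : ℝ) T → ℕ)) => κ E) hext
  simp only [Measure.map_apply hWm hE, Measure.restrict_apply (hWm hE),
    withDensity_apply _ (hWm hE)] at h2
  rw [inter_comm]
  exact h2

end Mixture

end

/-! ### Measurability of `ξ` with respect to the stopped observation -/

section

theorem intervalIntegral_indicator_Iic {φ : ℝ → ℝ} {a b c : ℝ} (hab : a ≤ b) (hac : a ≤ c) :
    ∫ s in a..b, (Iic c).indicator φ s = ∫ s in a..(min b c), φ s := by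
  rw [intervalIntegral.integral_of_le hab, intervalIntegral.integral_of_le (le_min hab hac),
    setIntegral_indicator measurableSet_Iic, Ioc_inter_Iic]

theorem intervalIntegrable_indicator_Iic {φ : ℝ → ℝ}
    (hφ : ∀ a b, IntervalIntegrable φ volume a b) (c a b : ℝ) :
    IntervalIntegrable ((Iic c).indicator φ) volume a b := by
  rw [intervalIntegrable_iff]
  exact ((intervalIntegrable_iff.1 (hφ a b))).indicator measurableSet_Iic

theorem aestronglyMeasurable_log_div {Ω : Type*} {m mΩ : MeasurableSpace Ω} {P : Measure Ω}
    {F G : Ω → ℝ} (hF : AEStronglyMeasurable[m] F P) (hG : AEStronglyMeasurable[m] G P) :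
    AEStronglyMeasurable[m] (fun ω => Real.log (F ω / G ω)) P := by
  obtain ⟨F', hF', hFF'⟩ := hF
  obtain ⟨G', hG', hGG'⟩ := hG
  refine ⟨fun ω => Real.log (F' ω / G' ω),
    (hF'.measurable.div hG'.measurable).log.stronglyMeasurable, ?_⟩
  filter_upwards [hFF', hGG'] with ω h1 h2
  rw [h1, h2]

theorem aestronglyMeasurable_sum_range {Ω : Type*} {m mΩ : MeasurableSpace Ω} {P : Measure Ω}
    {F : ℕ → Ω → ℝ} {N : ℕ} (hF : ∀ i < N, AEStronglyMeasurable[m] (F i) P) :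
    AEStronglyMeasurable[m] (fun ω => ∑ i ∈ Finset.range N, F i ω) P := by
  induction N with
  | zero =>
    simp only [Finset.range_zero, Finset.sum_empty]
    exact aestronglyMeasurable_const
  | succ N ih =>
    simp_rw [Finset.sum_range_succ]
    exact (ih fun i hi => hF i (by omega)).add (hF N N.lt_succ_self)

theorem measurable_tau {Ω : Type*} {m : MeasurableSpace Ω} {T : ℝ} {X : ℝ → Ω → ℕ} {u : ℕ}
    (hX : ∀ ω, IsCountingPath T (fun t => X t ω)) (hT : 0 < T)
    (hu : 0 < u) (hXm : ∀ t ∈ Icc 0 T, Measurable[m] fun ω => min (X t ω) u) :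
    Measurable[m] (tau T u X) := by
  refine measurable_hitTime hT hX hu fun t ht => ?_
  convert (hXm t ⟨ht.1, ht.2.le⟩) (measurableSet_Ici (a := u)) using 1
  ext ω
  simp

variable {Ω S : Type*} {m mΩ : MeasurableSpace Ω} [MeasurableSpace S]
  {P : Measure Ω} [IsProbabilityMeasure P] {A : Set Ω} {T : ℝ} {X : ℝ → Ω → ℕ} {u : ℕ}
  {V : Ω → S} {μ : Measure S} {f g : S → ℝ → ℝ}

/-- For `ξ` to be measurable, up to a null set, with respect to a σ-algebra `m`, it is enough that
the capped path and the values of the stopped intensities are. The integral against the jumps is a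
limit of sums over the cells of the grids; the intensities are averaged over the preceding cell,
which has ended before the jump, and so before `τ`. -/
theorem aestronglyMeasurable_xiGiven [IsFiniteMeasure μ] (hm : m ≤ mΩ) (hA : MeasurableSet A)
    (hf : IsCoxGiven (P[|A]) T X V μ f) (hg : IsCoxGiven (P[|Aᶜ]) T X V μ g) (hT : 0 < T)
    (hu : 0 < u) (hXm : ∀ t ∈ Icc 0 T, Measurable[m] fun ω => min (X t ω) u)
    (hfm : ∀ s, Measurable[m] fun ω => (Iic (tau T u X ω)).indicator (f (V ω)) s)
    (hgm : ∀ s, Measurable[m] fun ω => (Iic (tau T u X ω)).indicator (g (V ω)) s) :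
    AEStronglyMeasurable[m] (xiGiven T u X V f g) P := by
  have hX := hf.counting
  set τ := tau T u X with hτdef
  have hτm : Measurable[m] τ := measurable_tau hX hT hu hXm
  have hτ : ∀ ω, τ ω ∈ Ioc 0 T := fun ω => hitTime_mem (hX ω) hT hu
  have hjoint : ∀ φ : S → ℝ → ℝ, Measurable (Function.uncurry φ) →
      Measurable (Function.uncurry fun ω s => (Iic (τ ω)).indicator (φ (V ω)) s) := by
    intro φ hφ
    have h1 : MeasurableSet {p : Ω × ℝ | p.2 ≤ τ p.1} :=
      measurableSet_le measurable_snd ((hτm.mono hm le_rfl).comp measurable_fst)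
    exact (hφ.comp ((hf.measurable_cov.comp measurable_fst).prodMk measurable_snd)).indicator h1
  have hint := ae_intervalIntegrable_comp hA hf hg hT
  have hF : ∀ a b, a ≤ b → AEStronglyMeasurable[m]
      (fun ω => ∫ s in a..b, (Iic (τ ω)).indicator (f (V ω)) s) P := fun a b hab =>
    aestronglyMeasurable_intervalIntegral hm (hjoint f hf.measurable_intensity) hfm
      (fun ω s => indicator_nonneg (fun r _ => (hf.pos _ r).le) s) hab
      (hint.mono fun ω h => intervalIntegrable_indicator_Iic h.1 _ a b)
  have hG : ∀ a b, a ≤ b → AEStronglyMeasurable[m]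
      (fun ω => ∫ s in a..b, (Iic (τ ω)).indicator (g (V ω)) s) P := fun a b hab =>
    aestronglyMeasurable_intervalIntegral hm (hjoint g hg.measurable_intensity) hgm
      (fun ω s => indicator_nonneg (fun r _ => (hg.pos _ r).le) s) hab
      (hint.mono fun ω h => intervalIntegrable_indicator_Iic h.2 _ a b)
  have hdrift : AEStronglyMeasurable[m]
      (fun ω => ∫ s in (0 : ℝ)..(τ ω), (g (V ω) s - f (V ω) s)) P := by
    refine ((hG 0 T hT.le).sub (hF 0 T hT.le)).congr ?_
    filter_upwards [hint] with ω hω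
    rw [Pi.sub_apply, intervalIntegral_indicator_Iic hT.le (hτ ω).1.le,
      intervalIntegral_indicator_Iic hT.le (hτ ω).1.le, min_eq_right (hτ ω).2,
      intervalIntegral.integral_sub (hω.2 _ _) (hω.1 _ _)]
  have hjump : AEStronglyMeasurable[m] (fun ω => jumpIntegral T (fun t => X t ω)
      (fun s => Real.log (f (V ω) s / g (V ω) s)) (τ ω)) P := by
    refine aestronglyMeasurable_of_tendsto (f := fun n ω => ∑ i ∈ Finset.range (n + 1),
      ((min (X (gridPt T n (i + 1)) ω) u - min (X (gridPt T n i) ω) u : ℕ) : ℝ) *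
        Real.log (cellMass T ((Iic (τ ω)).indicator (f (V ω))) n (i + 1 - 1 - 1) /
          cellMass T ((Iic (τ ω)).indicator (g (V ω))) n (i + 1 - 1 - 1))) (fun n => ?_) ?_
    · refine aestronglyMeasurable_sum_range fun i hi => ?_
      refine AEStronglyMeasurable.mul ?_ (aestronglyMeasurable_log_div
        (hF _ _ (gridPt_mono hT n (Nat.le_succ _))) (hG _ _ (gridPt_mono hT n (Nat.le_succ _))))
      have h1 : Measurable fun p : ℕ × ℕ => ((p.1 - p.2 : ℕ) : ℝ) := measurable_of_countable _
      exact (h1.comp ((hXm _ (gridPt_mem hT hi)).prodMk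
        (hXm _ (gridPt_mem hT hi.le)))).stronglyMeasurable.aestronglyMeasurable
    · filter_upwards [ae_cellLebesguePt_jumpTimes hA hf hg hT 1] with ω hω
      have hx := hX ω
      set D := (hx.cap u).finite_jumpTimes.toFinset with hD
      have hsub : ∀ s ∈ D, s ∈ jumpTimes T (fun t => X t ω) ∧ s ≤ τ ω := fun s hs => by
        rw [hD, Finite.mem_toFinset, jumpTimes_cap hx hT hu] at hs
        exact hs
      have hlim := tendsto_sum_log_cellMass hT (hf.pos (V ω)) (hg.pos (V ω)) 1 D
        (fun s hs => (hω s (hsub s hs).1).1) (fun s hs => (hω s (hsub s hs).1).2)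
      have hJ : jumpIntegral T (fun t => X t ω) (fun s => Real.log (f (V ω) s / g (V ω) s)) (τ ω) =
          ∑ s ∈ D, Real.log (f (V ω) s / g (V ω) s) := jumpIntegral_hitTime hx hT hu _
      rw [hJ]
      refine hlim.congr' ?_
      have hev : ∀ᶠ n in atTop, ∀ s ∈ D, 2 ≤ cellIdx T n s :=
        (Finset.eventually_all D).2 fun s hs =>
          (tendsto_cellIdx hT (hsub s hs).1.1.1).eventually_ge_atTop 2
      filter_upwards [hev] with n hn
      rw [(hx.cap u).sum_grid hT n fun j =>
        Real.log (cellMass T ((Iic (τ ω)).indicator (f (V ω))) n (j - 1 - 1) /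
          cellMass T ((Iic (τ ω)).indicator (g (V ω))) n (j - 1 - 1))]
      refine Finset.sum_congr rfl fun s hs => ?_
      have hend : gridPt T n (cellIdx T n s - 1 - 1 + 1) ≤ τ ω := by
        refine le_trans (le_of_lt ?_) (hsub s hs).2
        rw [← lt_cellIdx_iff hT]
        have := hn s hs
        omega
      have hcell : ∀ φ : ℝ → ℝ, cellMass T ((Iic (τ ω)).indicator φ) n (cellIdx T n s - 1 - 1) =
          cellMass T φ n (cellIdx T n s - 1 - 1) := fun φ => by
        have hle := gridPt_mono hT n (Nat.le_succ (cellIdx T n s - 1 - 1))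
        rw [cellMass, intervalIntegral_indicator_Iic hle (hle.trans hend), min_eq_left hend,
          cellMass]
      rw [hcell, hcell]
  exact hdrift.add hjump

end

/-! ### The intensity as a function of the trajectory of the covariable -/

section Intensity

variable {d : ℕ} {T : ℝ}

/-- The extension by the value `1` of an intensity on `[0, T] × [0, 1]^d` to the whole space. -/
noncomputable def lamExt (T : ℝ) (lam : ℝ → (Fin d → ℝ) → ℝ) : ℝ × (Fin d → ℝ) → ℝ :=
  Function.extend Subtype.val
    ((Icc (0 : ℝ) T ×ˢ Icc (0 : Fin d → ℝ) 1).domRestrict (Function.uncurry lam)) fun _ => 1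

theorem lamExt_of_mem {lam : ℝ → (Fin d → ℝ) → ℝ} {s : ℝ} {z : Fin d → ℝ} (hs : s ∈ Icc 0 T)
    (hz : z ∈ Icc (0 : Fin d → ℝ) 1) : lamExt T lam (s, z) = lam s z :=
  Subtype.val_injective.extend_apply _ _
    (⟨(s, z), hs, hz⟩ : ↥(Icc (0 : ℝ) T ×ˢ Icc (0 : Fin d → ℝ) 1))

theorem lamExt_of_notMem {lam : ℝ → (Fin d → ℝ) → ℝ} {s : ℝ} {z : Fin d → ℝ}
    (h : (s, z) ∉ Icc (0 : ℝ) T ×ˢ Icc (0 : Fin d → ℝ) 1) : lamExt T lam (s, z) = 1 :=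
  Function.extend_apply' _ _ _ fun ⟨p, hp⟩ => h (hp ▸ p.2)

theorem IsIntensity.measurable_lamExt {lam : ℝ → (Fin d → ℝ) → ℝ} (h : IsIntensity T lam) :
    Measurable (lamExt T lam) :=
  (MeasurableEmbedding.subtype_coe (measurableSet_Icc.prod measurableSet_Icc)).measurable_extend
    h.measurable measurable_const

theorem IsIntensity.lamExt_pos {lam : ℝ → (Fin d → ℝ) → ℝ} (h : IsIntensity T lam)
    (p : ℝ × (Fin d → ℝ)) : 0 < lamExt T lam p := by
  by_cases hp : p ∈ Icc (0 : ℝ) T ×ˢ Icc (0 : Fin d → ℝ) 1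
  · rw [lamExt_of_mem hp.1 hp.2]
    exact h.pos _ hp.1 _ hp.2
  · rw [lamExt_of_notMem hp]
    exact one_pos

/-- The intensity at time `s` as a function of the trajectory `v` of the covariable, where `h`
evaluates trajectories, measurably in time and trajectory. -/
noncomputable def pathIntensity {S : Type*} (hT : 0 ≤ T) (lam : ℝ → (Fin d → ℝ) → ℝ)
    (h : Icc (0 : ℝ) T × S → Fin d → ℝ) (v : S) (s : ℝ) : ℝ :=
  lamExt T lam (s, h (projIcc 0 T hT s, v))

variable {Ω : Type*} [mΩ : MeasurableSpace Ω] {Z : ℝ → Ω → Fin d → ℝ}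

theorem IsCovariable.measurable_pathOn (hZ : IsCovariable T Z) : Measurable (pathOn T Z) :=
  measurable_pi_lambda _ fun t => hZ.measurable t t.2

/-- A measurable evaluation of the trajectories of the covariable. -/
theorem IsCovariable.exists_eval (hZ : IsCovariable T Z) :
    ∃ h : Icc (0 : ℝ) T × (Icc (0 : ℝ) T → Fin d → ℝ) → Fin d → ℝ, Measurable h ∧
      ∀ (t : Icc (0 : ℝ) T) ω, Z t ω = h (t, pathOn T Z ω) := by
  have hle : (inferInstance : MeasurableSpace (Icc (0 : ℝ) T)).prod (sigmaOf (pathOn T Z)) ≤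
      MeasurableSpace.comap (fun p : Icc (0 : ℝ) T × Ω => (p.1, pathOn T Z p.2))
        inferInstance := by
    have h1 := comap_measurable (m := (inferInstance :
      MeasurableSpace (Icc (0 : ℝ) T × (Icc (0 : ℝ) T → Fin d → ℝ))))
      (fun p : Icc (0 : ℝ) T × Ω => (p.1, pathOn T Z p.2))
    refine sup_le (measurable_fst.comp h1).comap_le ?_
    rw [MeasurableSpace.comap_comp]
    exact (measurable_snd.comp h1).comap_le
  obtain ⟨h, hm, hh⟩ := (hZ.jointly_measurable.mono hle le_rfl).exists_eq_measurable_comp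
  exact ⟨h, hm, fun t ω => congrFun hh (t, ω)⟩

section Eval

variable {h : Icc (0 : ℝ) T × (Icc (0 : ℝ) T → Fin d → ℝ) → Fin d → ℝ}
  {lam : ℝ → (Fin d → ℝ) → ℝ}

theorem pathIntensity_apply (hT : 0 ≤ T) (hZ : IsCovariable T Z)
    (hh : ∀ (t : Icc (0 : ℝ) T) ω, Z t ω = h (t, pathOn T Z ω)) {s : ℝ} (hs : s ∈ Icc 0 T)
    (ω : Ω) : pathIntensity hT lam h (pathOn T Z ω) s = lam s (Z s ω) := by
  rw [pathIntensity, projIcc_of_mem hT hs, ← hh ⟨s, hs⟩ ω]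
  exact lamExt_of_mem hs (hZ.mem_cube s hs ω)

theorem measurable_pathIntensity (hT : 0 ≤ T) (hlam : IsIntensity T lam) (hm : Measurable h) :
    Measurable (Function.uncurry (pathIntensity hT lam h)) :=
  hlam.measurable_lamExt.comp (measurable_snd.prodMk
    (hm.comp ((continuous_projIcc.measurable.comp measurable_snd).prodMk measurable_fst)))

theorem intervalIntegrable_pathIntensity (hT : 0 ≤ T) {v : Icc (0 : ℝ) T → Fin d → ℝ}
    (hv : IntegrableOn (pathIntensity hT lam h v) (Icc 0 T)) (a b : ℝ) :
    IntervalIntegrable (pathIntensity hT lam h v) volume a b := by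
  rw [intervalIntegrable_iff, ← inter_union_sdiff (uIoc a b) (Icc 0 T)]
  refine (hv.mono_set inter_subset_right).union ?_
  have h1 : IntegrableOn (fun _ : ℝ => (1 : ℝ)) (uIoc a b \ Icc 0 T) :=
    (integrableOn_const (by simp)).mono_set sdiff_subset
  refine h1.congr_fun (fun s hs => ?_) (measurableSet_uIoc.diff measurableSet_Icc)
  exact (lamExt_of_notMem fun h' => hs.2 h'.1).symm

/-- In terms of joint laws instead of conditional expectations: `X` is a Cox process driven by the
trajectory of the covariable. -/
theorem IsCox.isCoxGiven {Q : Measure Ω} [IsProbabilityMeasure Q] {X : ℝ → Ω → ℕ}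
    (hX : IsCox Q T X Z lam) (hT : 0 ≤ T) (hZ : IsCovariable T Z) (hlam : IsIntensity T lam)
    (hm : Measurable h) (hh : ∀ (t : Icc (0 : ℝ) T) ω, Z t ω = h (t, pathOn T Z ω)) :
    IsCoxGiven Q T X (pathOn T Z) (Q.map (pathOn T Z)) (pathIntensity hT lam h) where
  counting := hX.counting
  measurable := hX.measurable
  measurable_cov := hZ.measurable_pathOn
  measurable_intensity := measurable_pathIntensity hT hlam hm
  pos := fun v s => hlam.lamExt_pos _
  intervalIntegrable := by
    have hmeas : MeasurableSet {v | IntegrableOn (pathIntensity hT lam h v) (Icc 0 T)} :=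
      measurableSet_integrable (measurable_pathIntensity hT hlam hm).stronglyMeasurable
    have hae : ∀ᵐ v ∂(Q.map (pathOn T Z)),
        IntegrableOn (pathIntensity hT lam h v) (Icc 0 T) := by
      rw [ae_map_iff hZ.measurable_pathOn.aemeasurable hmeas]
      filter_upwards [hX.integrable] with ω hω
      exact hω.congr_fun (fun s hs => (pathIntensity_apply hT hZ hh hs ω).symm) measurableSet_Icc
    filter_upwards [hae] with v hv
    exact intervalIntegrable_pathIntensity hT hv
  increments := by
    intro n t k ht htT B hB
    have hV := hZ.measurable_pathOn
    have hle : sigmaOf (pathOn T Z) ≤ mΩ := hV.comap_le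
    set E : Set Ω := {ω | ∀ i : Fin n, X (t i.succ) ω = X (t i.castSucc) ω + k i} with hE
    set w : (Icc (0 : ℝ) T → Fin d → ℝ) → ℝ := fun v =>
      ∏ i : Fin n, poissonProb (∫ s in (t i.castSucc)..(t i.succ), pathIntensity hT lam h v s)
        (k i) with hw
    have hEm : MeasurableSet E := by
      have : E = ⋂ i : Fin n, {ω | X (t i.succ) ω = X (t i.castSucc) ω + k i} := by
        ext; simp [hE]
      rw [this]
      exact MeasurableSet.iInter fun i => measurableSet_eq_fun (hX.measurable _ (htT _))
        ((hX.measurable _ (htT _)).add_const _)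
    have hwm : Measurable w := Finset.measurable_fun_prod _ fun i _ =>
      (measurable_poissonProb _).comp (measurable_intervalIntegral
        (measurable_pathIntensity hT hlam hm) measurable_id measurable_const measurable_const)
    have hw0 : ∀ v, 0 ≤ w v := fun v => Finset.prod_nonneg fun i _ =>
      poissonProb_nonneg (intervalIntegral.integral_nonneg (ht (Fin.castSucc_le_succ i))
        fun s _ => (hlam.lamExt_pos _).le) _
    have hcond : Q⟦E | sigmaOf (pathOn T Z)⟧ =ᵐ[Q] fun ω => w (pathOn T Z ω) := by
      refine (hX.increments n t k ht htT).trans (Eventually.of_forall fun ω => ?_)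
      refine Finset.prod_congr rfl fun i _ => ?_
      congr 1
      refine intervalIntegral.integral_congr fun s hs => ?_
      rw [uIcc_of_le (ht (Fin.castSucc_le_succ i))] at hs
      exact (pathIntensity_apply hT hZ hh
        ⟨(htT _).1.trans hs.1, hs.2.trans (htT _).2⟩ ω).symm
    have hwi : Integrable (fun ω => w (pathOn T Z ω)) Q := integrable_condExp.congr hcond
    have h1 : ∫ ω in pathOn T Z ⁻¹' B, w (pathOn T Z ω) ∂Q = Q.real (pathOn T Z ⁻¹' B ∩ E) := by
      rw [← setIntegral_congr_ae (hV hB) (hcond.mono fun ω hω _ => hω),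
        setIntegral_condExp hle ((integrable_const 1).indicator hEm) ⟨B, hB, rfl⟩,
        setIntegral_indicator hEm]
      simp
    rw [setLIntegral_map hB hwm.ennreal_ofReal hV, ← ofReal_measureReal, ← h1]
    exact ofReal_integral_eq_lintegral_ofReal hwi.restrict (Eventually.of_forall fun ω => hw0 _)

end Eval

end Intensity

/-! ### The Bayes rule -/

section Bayes

variable {Ω E : Type*} [mΩ : MeasurableSpace Ω] [MeasurableSpace E] {P : Measure Ω}
  [IsProbabilityMeasure P]

/-- The probability of error of a classifier which answers `1` on the event `D`. -/
theorem measureReal_error {O : Ω → E} (hO : Measurable O) {Y : Ω → ℤ} (hY : Measurable Y)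
    (hY_val : ∀ ω, Y ω = 1 ∨ Y ω = -1) {g : E → ℤ} (hg : IsClassifier g) :
    P.real {ω | g (O ω) ≠ Y ω} = P.real (Y ⁻¹' {1}) +
      ∫ ω in {ω | g (O ω) = 1}, (1 - 2 * (P⟦Y ⁻¹' {1} | sigmaOf O⟧) ω) ∂P := by
  have hA : MeasurableSet (Y ⁻¹' {1}) := hY (measurableSet_singleton 1)
  have hDm : MeasurableSet[sigmaOf O] {ω | g (O ω) = 1} :=
    ⟨g ⁻¹' {1}, hg.1 (measurableSet_singleton 1), rfl⟩
  have hD : MeasurableSet {ω | g (O ω) = 1} := hO.comap_le _ hDm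
  have hset : {ω | g (O ω) ≠ Y ω} =
      ({ω | g (O ω) = 1} \ Y ⁻¹' {1}) ∪ (Y ⁻¹' {1} \ {ω | g (O ω) = 1}) := by
    ext ω
    simp only [mem_ofPred_eq, mem_union, Set.mem_sdiff, mem_preimage, mem_singleton_iff]
    rcases hg.2 (O ω) with h | h <;> rcases hY_val ω with h' | h' <;> simp [h, h']
  have h1 := measureReal_inter_add_sdiff (μ := P) (s := {ω | g (O ω) = 1}) hA
  have h2 := measureReal_inter_add_sdiff (μ := P) (s := Y ⁻¹' {1}) hD
  rw [inter_comm] at h2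
  have h3 : ∫ ω in {ω | g (O ω) = 1}, (P⟦Y ⁻¹' {1} | sigmaOf O⟧) ω ∂P =
      P.real ({ω | g (O ω) = 1} ∩ Y ⁻¹' {1}) := by
    rw [setIntegral_condExp hO.comap_le ((integrable_const 1).indicator hA) hDm,
      setIntegral_indicator hA]
    simp
  have hci : Integrable (P⟦Y ⁻¹' {1} | sigmaOf O⟧) P := integrable_condExp
  rw [hset, measureReal_union disjoint_sdiff_sdiff (hA.diff hD),
    integral_sub (integrable_const 1) (hci.restrict.const_mul 2),
    integral_const_mul, h3]
  simp only [integral_const, measureReal_restrict_apply_univ, smul_eq_mul, mul_one]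
  linarith

theorem sgn_eq_one_iff {t : ℝ} : sgn t = 1 ↔ 0 < t := by
  unfold sgn
  split_ifs with h <;> simp [h]

theorem measurable_sgn : Measurable sgn :=
  Measurable.ite measurableSet_Ioi measurable_const measurable_const

/-- The Bayes rule `sgn (2 η - 1)` is a function of the observation and has the smallest
probability of error. -/
theorem exists_bayes_classifier {O : Ω → E} (hO : Measurable O) {Y : Ω → ℤ} (hY : Measurable Y)
    (hY_val : ∀ ω, Y ω = 1 ∨ Y ω = -1) :
    ∃ g : E → ℤ, IsClassifier g ∧
      (∀ ω, g (O ω) = sgn (2 * (P⟦Y ⁻¹' {1} | sigmaOf O⟧) ω - 1)) ∧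
      ∀ g' : E → ℤ, IsClassifier g' →
        P.real {ω | g (O ω) ≠ Y ω} ≤ P.real {ω | g' (O ω) ≠ Y ω} := by
  obtain ⟨φ, hφ, hηφ⟩ := (stronglyMeasurable_condExp (m := sigmaOf O) (μ := P)
    (f := (Y ⁻¹' {1}).indicator fun _ => (1 : ℝ))).measurable.exists_eq_measurable_comp
  have hηφ' : ∀ ω, (P⟦Y ⁻¹' {1} | sigmaOf O⟧) ω = φ (O ω) := fun ω => congrFun hηφ ω
  have hg : IsClassifier fun e => sgn (2 * φ e - 1) := by
    refine ⟨measurable_sgn.comp ((hφ.const_mul 2).sub_const 1), fun e => ?_⟩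
    simp only [sgn]
    split_ifs <;> simp
  refine ⟨_, hg, fun ω => by rw [hηφ' ω], fun g' hg' => ?_⟩
  rw [measureReal_error hO hY hY_val hg, measureReal_error hO hY hY_val hg']
  have hD : ∀ {k : E → ℤ}, IsClassifier k → MeasurableSet {ω | k (O ω) = 1} := fun hk =>
    (hk.1.comp hO) (measurableSet_singleton 1)
  have hi : Integrable (fun ω => 1 - 2 * (P⟦Y ⁻¹' {1} | sigmaOf O⟧) ω) P :=
    (integrable_const 1).sub (integrable_condExp.const_mul 2)
  rw [← integral_indicator (hD hg), ← integral_indicator (hD hg')]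
  -- the event on which `g` answers `1` is where the integrand is negative
  refine add_le_add_right (integral_mono (hi.indicator (hD hg)) (hi.indicator (hD hg'))
    fun ω => ?_) _
  simp only [indicator, mem_ofPred_eq, sgn_eq_one_iff, hηφ']
  split_ifs <;> linarith

end Bayes

/-! ### The posterior probability given the stopped observation -/

section Observation

variable {d : ℕ} {T : ℝ} {u : ℕ} {Ω : Type*}
  {X : ℝ → Ω → ℕ} {Z : ℝ → Ω → Fin d → ℝ} {lam lamPos lamNeg : ℝ → (Fin d → ℝ) → ℝ}
  {h : Icc (0 : ℝ) T × (Icc (0 : ℝ) T → Fin d → ℝ) → Fin d → ℝ}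

theorem obs_fst (hX : ∀ ω, IsCountingPath T (fun t => X t ω)) (hT : 0 < T) (hu : 0 < u) (ω : Ω)
    (t : Icc (0 : ℝ) T) : (obs T u X Z ω).1 t = min (X t ω) u :=
  apply_min_hitTime (hX ω) hT hu t.2

/-- The stopped observation is a function of the trajectory of the covariable and of the capped
path. -/
theorem measurable_obs (hX : ∀ ω, IsCountingPath T (fun t => X t ω)) (hT : 0 < T) (hu : 0 < u)
    (hm : Measurable h) (hh : ∀ (t : Icc (0 : ℝ) T) ω, Z t ω = h (t, pathOn T Z ω)) :
    Measurable[MeasurableSpace.comap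
      (fun ω => (pathOn T Z ω, fun t : Icc (0 : ℝ) T => min (X t ω) u)) inferInstance]
      (obs T u X Z) := by
  set W : Ω → (Icc (0 : ℝ) T → Fin d → ℝ) × (Icc (0 : ℝ) T → ℕ) :=
    fun ω => (pathOn T Z ω, fun t : Icc (0 : ℝ) T => min (X t ω) u) with hW
  set m' : MeasurableSpace Ω := MeasurableSpace.comap W inferInstance with hm'
  have hWm : Measurable[m'] W := comap_measurable W
  have hXm : ∀ t ∈ Icc 0 T, Measurable[m'] fun ω => min (X t ω) u := fun t ht =>
    (measurable_pi_apply (⟨t, ht⟩ : Icc (0 : ℝ) T)).comp (measurable_snd.comp hWm)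
  have hτm : Measurable[m'] (tau T u X) := measurable_tau hX hT hu hXm
  have hτ : ∀ ω, tau T u X ω ∈ Ioc 0 T := fun ω => hitTime_mem (hX ω) hT hu
  refine Measurable.prodMk (measurable_pi_lambda _ fun t => ?_)
    (measurable_pi_lambda _ fun t => ?_)
  · have : (fun ω => (obs T u X Z ω).1 t) = fun ω => min (X t ω) u :=
      funext fun ω => obs_fst hX hT hu ω t
    exact this ▸ hXm t t.2
  · have hmem : ∀ ω, min (t : ℝ) (tau T u X ω) ∈ Icc 0 T := fun ω =>
      ⟨le_min t.2.1 (hτ ω).1.le, (min_le_left _ _).trans t.2.2⟩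
    have : (fun ω => pathOn T (stopAt Z (tau T u X)) ω t) = fun ω =>
        h (⟨min (t : ℝ) (tau T u X ω), hmem ω⟩, pathOn T Z ω) :=
      funext fun ω => hh ⟨_, hmem ω⟩ ω
    rw [this]
    exact hm.comp (((measurable_const.min hτm).subtype_mk).prodMk (measurable_fst.comp hWm))

variable [MeasurableSpace Ω]

theorem xi_eq_xiGiven (hX : ∀ ω, IsCountingPath T (fun t => X t ω)) (hT : 0 < T) (hu : 0 < u)
    (hZ : IsCovariable T Z) (hh : ∀ (t : Icc (0 : ℝ) T) ω, Z t ω = h (t, pathOn T Z ω)) (ω : Ω) :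
    xi T u X Z lamPos lamNeg ω = xiGiven T u X (pathOn T Z) (pathIntensity hT.le lamPos h)
      (pathIntensity hT.le lamNeg h) ω := by
  have hτ : tau T u X ω ∈ Ioc 0 T := hitTime_mem (hX ω) hT hu
  rw [xi, xiGiven, min_eq_right hτ.2]
  congr 1
  · refine intervalIntegral.integral_congr fun s hs => ?_
    rw [uIcc_of_le hτ.1.le] at hs
    have hs' : s ∈ Icc 0 T := ⟨hs.1, hs.2.trans hτ.2⟩
    simp only [pathIntensity_apply hT.le hZ hh hs']
  · refine finsum_mem_congr rfl fun s hs => ?_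
    have hs' : s ∈ Icc 0 T := ⟨hs.1.1.1.le, hs.1.1.2⟩
    simp only [pathIntensity_apply hT.le hZ hh hs']

/-- The value at time `s` of an intensity stopped at `τ` is a function of the stopped
observation. -/
theorem measurable_indicator_pathIntensity (hX : ∀ ω, IsCountingPath T (fun t => X t ω))
    (hT : 0 < T) (hu : 0 < u) (hZ : IsCovariable T Z) (hlam : IsIntensity T lam)
    (hh : ∀ (t : Icc (0 : ℝ) T) ω, Z t ω = h (t, pathOn T Z ω)) (s : ℝ) :
    Measurable[sigmaOf (obs T u X Z)] fun ω =>
      (Iic (tau T u X ω)).indicator (pathIntensity hT.le lam h (pathOn T Z ω)) s := by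
  have hobs : Measurable[sigmaOf (obs T u X Z)] (obs T u X Z) := comap_measurable _
  have hτm : Measurable[sigmaOf (obs T u X Z)] (tau T u X) := by
    refine measurable_tau hX hT hu fun t ht => ?_
    have : (fun ω => min (X t ω) u) = fun ω => (obs T u X Z ω).1 ⟨t, ht⟩ :=
      funext fun ω => (obs_fst hX hT hu ω ⟨t, ht⟩).symm
    rw [this]
    exact (measurable_pi_apply _).comp (measurable_fst.comp hobs)
  have heq : (fun ω => (Iic (tau T u X ω)).indicator
        (pathIntensity hT.le lam h (pathOn T Z ω)) s) =
      {ω | s ≤ tau T u X ω}.indicator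
        fun ω => lamExt T lam (s, (obs T u X Z ω).2 (projIcc 0 T hT.le s)) := by
    ext ω
    by_cases hs : s ≤ tau T u X ω
    · rw [indicator_of_mem (show s ∈ Iic (tau T u X ω) from hs),
        indicator_of_mem (show ω ∈ {ω | s ≤ tau T u X ω} from hs)]
      by_cases hsT : s ∈ Icc 0 T
      · rw [pathIntensity_apply hT.le hZ hh hsT, projIcc_of_mem hT.le hsT]
        have : (obs T u X Z ω).2 ⟨s, hsT⟩ = Z s ω := by
          change Z (min s (tau T u X ω)) ω = Z s ω
          rw [min_eq_left hs]
        rw [this, lamExt_of_mem hsT (hZ.mem_cube s hsT ω)]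
      · rw [pathIntensity, lamExt_of_notMem fun h' => hsT h'.1,
          lamExt_of_notMem fun h' => hsT h'.1]
    · rw [indicator_of_notMem (show s ∉ Iic (tau T u X ω) from hs),
        indicator_of_notMem (show ω ∉ {ω | s ≤ tau T u X ω} from hs)]
  rw [heq]
  exact (hlam.measurable_lamExt.comp (measurable_const.prodMk
    ((measurable_pi_apply _).comp (measurable_snd.comp hobs)))).indicator
    (measurableSet_le measurable_const hτm)

/-- The law of the covariable given an event which is independent of it. -/
theorem map_cond_eq {P : Measure Ω} [IsProbabilityMeasure P] {S : Type*} [MeasurableSpace S]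
    {V : Ω → S} (hV : Measurable V) {Y : Ω → ℤ} (hY : Measurable Y) (hVY : IndepFun V Y P) {y : ℤ}
    (hy : P (Y ⁻¹' {y}) ≠ 0) : (P[|Y ⁻¹' {y}]).map V = P.map V := by
  ext B hB
  rw [Measure.map_apply hV hB, Measure.map_apply hV hB,
    cond_apply (hY (measurableSet_singleton y)), inter_comm,
    hVY.measure_inter_preimage_eq_mul _ _ hB (measurableSet_singleton y), mul_comm, mul_assoc,
    ENNReal.mul_inv_cancel hy (measure_ne_top _ _), mul_one]

end Observation

end CoxMixture


open CoxMixture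

theorem theorem1 {Ω : Type*} [MeasurableSpace Ω] (P : Measure Ω) [IsProbabilityMeasure P]
    (T : ℝ) (hT : 0 < T) (u : ℕ) (hu : 0 < u) (d : ℕ)
    -- the label
    (Y : Ω → ℤ) (hY : Measurable Y) (hY_val : ∀ ω, Y ω = 1 ∨ Y ω = -1)
    (pPos pNeg : ℝ) (hpPos : P.real (Y ⁻¹' {1}) = pPos) (hpNeg : P.real (Y ⁻¹' {-1}) = pNeg)
    (hpPos_pos : 0 < pPos) (hpNeg_pos : 0 < pNeg)
    -- the covariable, a measurable process with values in the unit cube, independent of the label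
    (Z : ℝ → Ω → Fin d → ℝ)
    (hZ : CoxMixture.IsCovariable T Z)
    (hZY : IndepFun (CoxMixture.pathOn T Z) Y P)
    -- the two intensities
    (lamPos lamNeg : ℝ → (Fin d → ℝ) → ℝ)
    (hlamPos : CoxMixture.IsIntensity T lamPos) (hlamNeg : CoxMixture.IsIntensity T lamNeg)
    -- the mixture of Cox processes
    (X : ℝ → Ω → ℕ)
    (hXPos : CoxMixture.IsCox (ProbabilityTheory.cond P (Y ⁻¹' {1})) T X Z lamPos)
    (hXNeg : CoxMixture.IsCox (ProbabilityTheory.cond P (Y ⁻¹' {-1})) T X Z lamNeg) :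
    -- the posterior probabilities given the stopped observation
    (P⟦Y ⁻¹' {1} | CoxMixture.sigmaOf (CoxMixture.obs T u X Z)⟧ =ᵐ[P] fun ω =>
        pPos / (pNeg * Real.exp (-CoxMixture.xi T u X Z lamPos lamNeg ω) + pPos)) ∧
    (P⟦Y ⁻¹' {-1} | CoxMixture.sigmaOf (CoxMixture.obs T u X Z)⟧ =ᵐ[P] fun ω =>
        pNeg / (pPos * Real.exp (CoxMixture.xi T u X Z lamPos lamNeg ω) + pNeg)) ∧
    -- the Bayes rule `sign (2 η - 1)`
    ((fun ω => CoxMixture.sgn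
        (2 * (P⟦Y ⁻¹' {1} | CoxMixture.sigmaOf (CoxMixture.obs T u X Z)⟧) ω - 1)) =ᵐ[P] fun ω =>
        CoxMixture.sgn
          (CoxMixture.xi T u X Z lamPos lamNeg ω - Real.log (pNeg / pPos))) ∧
    -- this rule is a classifier based on the observation, with minimal probability of error
    (∃ g : CoxMixture.ObsSpace T d → ℤ, CoxMixture.IsClassifier g ∧
      ((fun ω => g (CoxMixture.obs T u X Z ω)) =ᵐ[P] fun ω =>
        CoxMixture.sgn
          (CoxMixture.xi T u X Z lamPos lamNeg ω - Real.log (pNeg / pPos))) ∧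
      ∀ g' : CoxMixture.ObsSpace T d → ℤ, CoxMixture.IsClassifier g' →
        P.real {ω | g (CoxMixture.obs T u X Z ω) ≠ Y ω} ≤
          P.real {ω | g' (CoxMixture.obs T u X Z ω) ≠ Y ω}) := by
  have hA : MeasurableSet (Y ⁻¹' {1}) := hY (measurableSet_singleton 1)
  have hAc : (Y ⁻¹' {1})ᶜ = Y ⁻¹' {-1} := by
    ext ω
    simp only [mem_compl_iff, mem_preimage, mem_singleton_iff]
    rcases hY_val ω with h | h <;> simp [h]
  have hP1 : P (Y ⁻¹' {1}) ≠ 0 := fun h0 => by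
    rw [measureReal_def, h0, ENNReal.toReal_zero] at hpPos
    exact hpPos_pos.ne hpPos
  have hP2 : P (Y ⁻¹' {-1}) ≠ 0 := fun h0 => by
    rw [measureReal_def, h0, ENNReal.toReal_zero] at hpNeg
    exact hpNeg_pos.ne hpNeg
  have : IsProbabilityMeasure (P[|Y ⁻¹' {1}]) := cond_isProbabilityMeasure hP1
  have : IsProbabilityMeasure (P[|Y ⁻¹' {-1}]) := cond_isProbabilityMeasure hP2
  obtain ⟨h, hm, hh⟩ := hZ.exists_eval
  have hV := hZ.measurable_pathOn
  have : IsProbabilityMeasure (P.map (pathOn T Z)) :=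
    Measure.isProbabilityMeasure_map hV.aemeasurable
  have hf := hXPos.isCoxGiven hT.le hZ hlamPos hm hh
  have hg := hXNeg.isCoxGiven hT.le hZ hlamNeg hm hh
  rw [map_cond_eq hV hY hZY hP1] at hf
  rw [map_cond_eq hV hY hZY hP2, ← hAc] at hg
  rw [← hAc] at hpNeg
  have hX := hXPos.counting
  have hxi : xi T u X Z lamPos lamNeg = xiGiven T u X (pathOn T Z)
      (pathIntensity hT.le lamPos h) (pathIntensity hT.le lamNeg h) :=
    funext fun ω => xi_eq_xiGiven hX hT hu hZ hh ω
  -- the whole trajectory of the covariable together with the stopped path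
  set W : Ω → (Icc (0 : ℝ) T → Fin d → ℝ) × (Icc (0 : ℝ) T → ℕ) :=
    fun ω => (pathOn T Z ω, fun t : Icc (0 : ℝ) T => min (X t ω) u) with hW
  have hWm : Measurable W := hV.prodMk (measurable_pi_lambda _ fun t =>
    (measurable_of_countable fun j : ℕ => min j u).comp (hXPos.measurable t t.2))
  have hobsW : sigmaOf (obs T u X Z) ≤ MeasurableSpace.comap W inferInstance :=
    (measurable_obs hX hT hu hm hh).comap_le
  have hobs : Measurable (obs T u X Z) :=
    (measurable_obs hX hT hu hm hh).mono hWm.comap_le le_rfl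
  have hle : sigmaOf (obs T u X Z) ≤ (inferInstance : MeasurableSpace Ω) := hobs.comap_le
  have hxim : AEStronglyMeasurable[sigmaOf (obs T u X Z)] (xi T u X Z lamPos lamNeg) P := by
    rw [hxi]
    refine aestronglyMeasurable_xiGiven hle hA hf hg hT hu (fun t ht => ?_)
      (measurable_indicator_pathIntensity hX hT hu hZ hlamPos hh)
      (measurable_indicator_pathIntensity hX hT hu hZ hlamNeg hh)
    have h1 : (fun ω => min (X t ω) u) = fun ω => (obs T u X Z ω).1 ⟨t, ht⟩ :=
      funext fun ω => (obs_fst hX hT hu ω ⟨t, ht⟩).symm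
    rw [h1]
    exact (measurable_pi_apply _).comp (measurable_fst.comp (comap_measurable _))
  set η : Ω → ℝ := fun ω =>
    pPos / (pNeg * Real.exp (-xi T u X Z lamPos lamNeg ω) + pPos) with hη
  have hη0 : ∀ ω, 0 ≤ η ω := fun ω => by simp only [hη]; positivity
  have hη1 : ∀ ω, η ω ≤ 1 := fun ω => by
    simp only [hη]
    exact div_le_one_of_le₀ (le_add_of_nonneg_left (by positivity)) (by positivity)
  have hηm : AEStronglyMeasurable[sigmaOf (obs T u X Z)] η P := by
    obtain ⟨ξ', hξ', hξξ'⟩ := hxim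
    refine ⟨fun ω => pPos / (pNeg * Real.exp (-ξ' ω) + pPos), ?_, ?_⟩
    · exact (measurable_const.div
        ((hξ'.measurable.neg.exp.const_mul pNeg).add_const pPos)).stronglyMeasurable
    · filter_upwards [hξξ'] with ω hω
      simp only [hη, hω]
  have hηm' : AEStronglyMeasurable η P := hηm.mono hle
  have hηi : Integrable η P := Integrable.of_bound hηm' 1 (Eventually.of_forall fun ω => by
    rw [Real.norm_eq_abs, abs_of_nonneg (hη0 ω)]
    exact hη1 ω)
  have hpost : P⟦Y ⁻¹' {1} | sigmaOf (obs T u X Z)⟧ =ᵐ[P] η := by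
    refine (ae_eq_condExp_of_forall_setIntegral_eq hle ((integrable_const 1).indicator hA)
      (fun _ _ _ => hηi.integrableOn) (fun D hD _ => ?_) hηm).symm
    obtain ⟨E, hE, rfl⟩ := hobsW D hD
    have hbayes := measure_inter_preimage hA hf hg hT hu (hpPos ▸ hpPos_pos)
      (hpNeg ▸ hpNeg_pos) hE
    rw [← hxi, hpPos, hpNeg] at hbayes
    rw [setIntegral_indicator hA, integral_eq_lintegral_of_nonneg_ae
      (Eventually.of_forall hη0) hηm'.restrict]
    simp only [hη, integral_const, measureReal_restrict_apply_univ, smul_eq_mul, mul_one]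
    rw [measureReal_def, inter_comm]
    exact congrArg ENNReal.toReal hbayes.symm
  have hsgn : (fun ω => sgn (2 * (P⟦Y ⁻¹' {1} | sigmaOf (obs T u X Z)⟧) ω - 1)) =ᵐ[P] fun ω =>
      sgn (xi T u X Z lamPos lamNeg ω - Real.log (pNeg / pPos)) := by
    filter_upwards [hpost] with ω hω
    have hiff : 0 < 2 * η ω - 1 ↔ 0 < xi T u X Z lamPos lamNeg ω - Real.log (pNeg / pPos) := by
      have hden : 0 < pNeg * Real.exp (-xi T u X Z lamPos lamNeg ω) + pPos := by positivity
      have h1 : 2 * η ω - 1 = (pPos - pNeg * Real.exp (-xi T u X Z lamPos lamNeg ω)) /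
          (pNeg * Real.exp (-xi T u X Z lamPos lamNeg ω) + pPos) := by
        simp only [hη]
        field_simp
        ring
      rw [h1, div_pos_iff_of_pos_right hden, sub_pos, sub_pos,
        Real.log_lt_iff_lt_exp (by positivity), Real.exp_neg, div_lt_iff₀ hpPos_pos,
        ← div_eq_mul_inv, div_lt_iff₀ (Real.exp_pos _), mul_comm pPos]
    rw [hω]
    simp only [sgn, hiff]
  refine ⟨hpost, ?_, hsgn, ?_⟩
  · have hsum : P⟦Y ⁻¹' {-1} | sigmaOf (obs T u X Z)⟧ =ᵐ[P]
        fun ω => 1 - (P⟦Y ⁻¹' {1} | sigmaOf (obs T u X Z)⟧) ω := by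
      have h1 : (Y ⁻¹' {-1}).indicator (fun _ => (1 : ℝ)) =
          (fun _ => (1 : ℝ)) - (Y ⁻¹' {1}).indicator fun _ => (1 : ℝ) := by
        rw [← hAc, indicator_compl]
      rw [h1]
      refine (condExp_sub (integrable_const 1) ((integrable_const 1).indicator hA) _).trans ?_
      rw [condExp_const hle]
      rfl
    filter_upwards [hsum, hpost] with ω h1 h2
    rw [h1, h2]
    simp only [hη]
    rw [Real.exp_neg]
    have := Real.exp_pos (xi T u X Z lamPos lamNeg ω)
    field_simp
    ring
  · obtain ⟨g, hg1, hg2, hg3⟩ := exists_bayes_classifier (P := P) hobs hY hY_val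
    exact ⟨g, hg1, EventuallyEq.trans (Eventually.of_forall hg2) hsgn, hg3⟩
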